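/- **Standing assumptions.** Let $1<p<\infty$. Let $(X,d,\mu)$ be a proper metric space (bounded closed sets are compact) with a Borel measure $\mu$ (completed) such that $0<\mu(B)<\infty$ for all open balls $B$ (of positive radius). Assume that $X$ supports a $(p,p)$-Poincaré inequality: there are constants $C>0$ and $\lambda\ge1$ such that for all balls $B=B(x,r)$, all integrable functions $u\colon X\to[-\infty,\infty]$ and all upper gradients $g$ of $u$, $$\Bigl(\frac1{\mu(B)}\int_B|u-u_B|^p\,d\mu\Bigr)^{1/p}\le C\operatorname{diam}(B)\Bigl(\frac1{\mu(\lambda B)}\int_{\lambda B}g^p\,d\mu\Bigr)^{1/p},\qquad u_B=\frac1{\mu(B)}\int_B u\,d\mu .$$ Let $\Omega\subset X$ be a nonempty (possibly unbounded) open set with $C_p(X\setminus\Omega)>0$. **Definitions.** A curve is a nonconstant rectifiable continuous map from a compact interval, parametrized by arc length. Let $E\subset X$ be a Borel set. A Borel function $g\colon E\to[0,\infty]$ is an upper gradient of $u\colon E\to[-\infty,\infty]$ if $|u(x)-u(y)|\le\int_\gamma g\,ds$ for every curve $\gamma$ in $E$ with endpoints $x,y$ (the left-hand side is $\infty$ if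 $u(x)$ or $u(y)$ is infinite). A measurable $g$ is a $p$-weak upper gradient if this holds for all curves in $E$ except for a family $\Gamma$ with $\operatorname{Mod}_p(\Gamma)=\inf_\rho\int_X\rho^p\,d\mu=0$, where the infimum is over all Borel $\rho\ge0$ with $\int_\gamma\rho\,ds\ge1$ for all $\gamma\in\Gamma$. $D^p(E)$ is the set of measurable $u\colon E\to[-\infty,\infty]$ that have an upper gradient in $L^p(E)$; for such $u$, $g_u$ denotes the minimal $p$-weak upper gradient, that is, the ($\mu$-a.e. unique) one in $L^p(E)$ that is $\mu$-a.e. at most every other one in $L^p(E)$. $D^p_0(\Omega)$ is the set of restrictions to $\Omega$ of functions in $D^p(X)$ that vanish on $X\setminus\Omega$. The capacity of $A\subset X$ is $C_p(A)=\inf_u\int_X(|u|^p+g_u^p)\,d\mu$ over all $u\in D^p(X)$ with $\int_X|u|^p\,d\mu<\infty$ and $u\ge1$ on $A$; "q.e." means outside a set of capacity zero. For $\psi\colon\Omega\to[-\infty,\infty]$ and $f\in D^p(\Omega)$ let $$\mathcal K_{\psi,f}=\{v\in D^p(\Omega): v-f\in D^p_0(\Omega)\text{ and }v\ge\psi\text{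 q.e. in }\Omega\}.$$ (Where a difference has the form $\infty-\infty$ or $(-\infty)-(-\infty)$ it is given the value $-\infty$; this happens only on a set of capacity zero.) A function $u$ is a solution of the $\mathcal K_{\psi,f}$-obstacle problem if $u\in\mathcal K_{\psi,f}$ and $\int_\Omega g_u^p\,d\mu\le\int_\Omega g_v^p\,d\mu$ for all $v\in\mathcal K_{\psi,f}$. **Lemma (comparison principle).** For $j=1,2$ let $\psi_j\colon\Omega\to[-\infty,\infty]$ and $f_j\in D^p(\Omega)$, and let $u_j$ be a solution of the $\mathcal K_{\psi_j,f_j}$-obstacle problem. If $\psi_1\le\psi_2$ q.e. in $\Omega$ and $(f_1-f_2)_+=\max\{f_1-f_2,0\}\in D^p_0(\Omega)$, then $u_1\le u_2$ q.e. in $\Omega$. -/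

import Mathlib

open MeasureTheory Set Metric
open scoped ENNReal

/-!  Analysis on a metric measure space `(X, d, μ)`.  For a Borel subset `E` of `X`, viewed as a
metric measure space with the restrictions of `d` and `μ`, functions on `E` are represented by
functions on `X` of which only the values on `E` are used, and curves in `E` by curves in `X` with
image in `E`.  Measurability with respect to the completion of the Borel σ-algebra is expressed
by `AEMeasurable`.  -/

namespace MetricObstacle

/-- A curve: a rectifiable nonconstant continuous map from a compact interval into `X`,
parametrized by arc length, so that the interval is `[0, length]`. Unit speed on `[0, length]`
makes the map 1-Lipschitz there, hence continuous. -/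
structure Curve (X : Type*) [MetricSpace X] where
  /-- the parametrization; only its values on `[0, length]` are relevant -/
  toFun : ℝ → X
  /-- the length of the curve -/
  length : ℝ
  length_pos : 0 < length
  unitSpeed : HasUnitSpeedOn toFun (Icc 0 length)

section Curves

variable {X : Type*} [MetricSpace X]

/-- The image of the curve is contained in `E`. -/
def Curve.IsIn (γ : Curve X) (E : Set X) : Prop :=
  ∀ t ∈ Icc 0 γ.length, γ.toFun t ∈ E

/-- The curve integral `∫_γ g ds`. -/
noncomputable def Curve.integral (γ : Curve X) (g : X → ℝ≥0∞) : ℝ≥0∞ :=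
  ∫⁻ t in Icc 0 γ.length, g (γ.toFun t)

open Classical in
/-- `|a - b|` for extended reals, infinite when at least one of `a`, `b` is infinite. -/
noncomputable def gap (a b : EReal) : ℝ≥0∞ :=
  if (a ≠ ⊤ ∧ a ≠ ⊥) ∧ (b ≠ ⊤ ∧ b ≠ ⊥) then ENNReal.ofReal |a.toReal - b.toReal| else ⊤

/-- The upper gradient inequality for the function `u` and the pair `g` along the curve `γ`. -/
def UpperGradientIneq (u : X → EReal) (g : X → ℝ≥0∞) (γ : Curve X) : Prop :=
  gap (u (γ.toFun 0)) (u (γ.toFun γ.length)) ≤ γ.integral g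

variable [MeasurableSpace X]

/-- `g` is an upper gradient of `u` in `E`: it is Borel and the upper gradient inequality holds
along every curve in `E`. -/
def IsUpperGradient (E : Set X) (u : X → EReal) (g : X → ℝ≥0∞) : Prop :=
  Measurable g ∧ ∀ γ : Curve X, γ.IsIn E → UpperGradientIneq u g γ

/-- The `p`-modulus of a family of curves. For a family of curves in a Borel set `E` this is also
the modulus with respect to `E`, since `ρ` may be replaced by `0` outside `E`. -/
noncomputable def modulus (μ : Measure X) (p : ℝ) (Γ : Set (Curve X)) : ℝ≥0∞ :=
  ⨅ (ρ : X → ℝ≥0∞) (_ : Measurable ρ) (_ : ∀ γ ∈ Γ, 1 ≤ γ.integral ρ), ∫⁻ x, ρ x ^ p ∂μ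

/-- `g` is a `p`-weak upper gradient of `u` in `E`: it is measurable and the upper gradient
inequality holds along `p`-almost every curve in `E`. -/
def IsWeakUpperGradient (μ : Measure X) (p : ℝ) (E : Set X) (u : X → EReal) (g : X → ℝ≥0∞) :
    Prop :=
  AEMeasurable g (μ.restrict E) ∧
    modulus μ p {γ : Curve X | γ.IsIn E ∧ ¬ UpperGradientIneq u g γ} = 0

/-- Membership in the Dirichlet space `D^p(E)`: measurable extended real-valued functions that
have an upper gradient in `L^p(E)`. -/
def MemDirichlet (μ : Measure X) (p : ℝ) (E : Set X) (u : X → EReal) : Prop :=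
  AEMeasurable u (μ.restrict E) ∧
    ∃ g : X → ℝ≥0∞, IsUpperGradient E u g ∧ ∫⁻ x in E, g x ^ p ∂μ < ∞

/-- Membership in `D^p_0(E)`: restrictions to `E` of functions in `D^p(X)` that vanish outside
`E`. -/
def MemDirichletZero (μ : Measure X) (p : ℝ) (E : Set X) (u : X → EReal) : Prop :=
  ∃ w : X → EReal, MemDirichlet μ p univ w ∧ (∀ x ∉ E, w x = 0) ∧ ∀ x ∈ E, w x = u x

/-- `g` is a minimal `p`-weak upper gradient of `u` in `E`: it is one in `L^p(E)` and lies a.e.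
below all others in `L^p(E)`. -/
def IsMinimalWeakUpperGradient (μ : Measure X) (p : ℝ) (E : Set X) (u : X → EReal)
    (g : X → ℝ≥0∞) : Prop :=
  IsWeakUpperGradient μ p E u g ∧ ∫⁻ x in E, g x ^ p ∂μ < ∞ ∧
    ∀ g' : X → ℝ≥0∞, IsWeakUpperGradient μ p E u g' → ∫⁻ x in E, g' x ^ p ∂μ < ∞ →
      ∀ᵐ x ∂μ.restrict E, g x ≤ g' x

open Classical in
/-- The minimal `p`-weak upper gradient `g_u` of `u` in `E`, unique up to null sets (and infinite
by convention where no minimal `p`-weak upper gradient exists). -/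
noncomputable def minimalGradient (μ : Measure X) (p : ℝ) (E : Set X) (u : X → EReal) :
    X → ℝ≥0∞ :=
  if h : ∃ g, IsMinimalWeakUpperGradient μ p E u g then h.choose else fun _ => ⊤

/-- The `p`-energy `∫_E g_u^p dμ`. -/
noncomputable def energy (μ : Measure X) (p : ℝ) (E : Set X) (u : X → EReal) : ℝ≥0∞ :=
  ∫⁻ x in E, minimalGradient μ p E u x ^ p ∂μ

/-- The `p`-th power of the Newtonian norm of `u` on `X`. -/
noncomputable def newtonNormPow (μ : Measure X) (p : ℝ) (u : X → EReal) : ℝ≥0∞ :=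
  ∫⁻ x, (u x).abs ^ p ∂μ + energy μ p univ u

/-- Membership in the Newtonian space `N^{1,p}(X)`. -/
def MemNewton (μ : Measure X) (p : ℝ) (u : X → EReal) : Prop :=
  MemDirichlet μ p univ u ∧ newtonNormPow μ p u < ∞

/-- The Sobolev capacity `C_p(A)`. -/
noncomputable def capacity (μ : Measure X) (p : ℝ) (A : Set X) : ℝ≥0∞ :=
  ⨅ (u : X → EReal) (_ : MemNewton μ p u) (_ : ∀ x ∈ A, 1 ≤ u x), newtonNormPow μ p u

/-- `P` holds quasieverywhere in `E`: outside a subset of `E` of capacity zero. -/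
def QuasieverywhereIn (μ : Measure X) (p : ℝ) (E : Set X) (P : X → Prop) : Prop :=
  capacity μ p {x | x ∈ E ∧ ¬ P x} = 0

/-- `X` supports a `(q, p)`-Poincaré inequality. The function `u` is integrable, hence finite
a.e., so that `toReal` recovers it up to null sets. -/
def SupportsPoincare (μ : Measure X) (q p : ℝ) : Prop :=
  ∃ C : ℝ, 0 < C ∧ ∃ lam : ℝ, 1 ≤ lam ∧
    ∀ (x : X) (r : ℝ), 0 < r →
      ∀ u : X → EReal, (∀ᵐ y ∂μ, u y ≠ ⊤ ∧ u y ≠ ⊥) → Integrable (fun y => (u y).toReal) μ →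
        ∀ g : X → ℝ≥0∞, IsUpperGradient univ u g →
          ((∫⁻ y in ball x r, ‖(u y).toReal - ⨍ z in ball x r, (u z).toReal ∂μ‖ₑ ^ q ∂μ) /
              μ (ball x r)) ^ (1 / q) ≤
            ENNReal.ofReal (C * diam (ball x r)) *
              ((∫⁻ y in ball x (lam * r), g y ^ p ∂μ) / μ (ball x (lam * r))) ^ (1 / p)

/-- The class `K_{ψ,f}(V)` of admissible functions. The difference `v - f` is the one of `EReal`;
it only involves a convention where `v` and `f` are the same infinity. -/
def obstacleClass (μ : Measure X) (p : ℝ) (V : Set X) (ψ f : X → EReal) : Set (X → EReal) :=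
  {v | MemDirichlet μ p V v ∧ MemDirichletZero μ p V (fun x => v x - f x) ∧
    QuasieverywhereIn μ p V (fun x => ψ x ≤ v x)}

/-- `u` is a solution of the `K_{ψ,f}(V)`-obstacle problem. -/
def IsObstacleSolution (μ : Measure X) (p : ℝ) (V : Set X) (ψ f u : X → EReal) : Prop :=
  u ∈ obstacleClass μ p V ψ f ∧
    ∀ v ∈ obstacleClass μ p V ψ f, energy μ p V u ≤ energy μ p V v

end Curves

end MetricObstacle

open MetricObstacle

open Filter Topology

namespace MetricObstacle

/-! ### Absolutely continuous functions on an interval -/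

/-! Idea of the proof. Let `g₁`, `g₂` be the minimal gradients of the solutions and let `A` be the
set where `u₂ < u₁` and both are finite. A function between `u₂` and `max u₁ u₂` competes with `u₂`,
and one between `min u₁ u₂` and `u₁` competes with `u₁`: the boundary condition holds because all
differences involved are dominated by `|u₁ - f₁| + |u₂ - f₂| + (f₁ - f₂)₊`, which extends by zero to
a function in `D^p(X)`.

Three competitors make both gradients vanish on `A` (`gradients_eq_zero`). The maximum gives `∫_A
g₂^p ≤ ∫_A g₁^p`. The average of `u₁` and `min u₁ u₂` gives `∫_A g₁^p ≤ ∫_A ((g₁ + g₂)/2)^p`. Strict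
convexity of the `p`-th power then forces `g₁ = g₂` a.e. on `A`. Finally `max u₂ (min u₁ c)` is
constant where `u₂ < c < u₁`, so minimality of `u₂` yields `g₂ = 0` there, and rational levels `c`
exhaust `A`.

Hence `(u₁ - u₂)₊` has gradient zero in `Ω`, and its extension `w` by zero is absolutely continuous
along `p`-almost every curve. Along such a curve `w` is locally constant where it is nonzero, so the
indicator of `{w ≠ 0}` is constant (`eventually_mem_iff_of_pos_sub`). By the Poincaré inequality
such a set is null or conull, and a null one has capacity zero (`capacity_eq_zero_or_compl`). The
complement of `{u₂ < u₁}` contains `X \ Ω`, which has positive capacity, so it is `{u₂ < u₁}` that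
has capacity zero.

Gradients of competitors are computed piecewise through derivatives along curves (`ACBound`): where
two functions agree along a curve, their derivatives agree a.e. -/

theorem ae_deriv_eq_zero_of_eq_zero (k : ℝ → ℝ) : ∀ᵐ t, k t = 0 → deriv k t = 0 := by
  -- All but countably many zeros are limits of zeros from the right. There a derivative, if it
  -- exists, must vanish; otherwise `deriv` is `0` by convention.
  have hc := countable_setOfPred_isolated_right_within (s := {t : ℝ | k t = 0})
  filter_upwards [hc.ae_notMem volume] with t ht hkt
  refine deriv_zero_of_frequently_const (c := 0) ?_
  have hf : ∃ᶠ y in 𝓝[>] t, k y = 0 := by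
    intro hev
    refine ht ⟨hkt, ?_⟩
    rw [inter_comm, nhdsWithin_inter', ← empty_mem_iff_bot, mem_inf_principal]
    filter_upwards [hev] with y hy hy' using hy hy'
  exact hf.filter_mono (nhdsWithin_mono _ fun y hy => ne_of_gt hy)

/-- This is what allows gradients to be pieced together pointwise, with no regularity of the sets on
which the pieces agree. -/
theorem ae_deriv_eq_of_eq (h w : ℝ → ℝ) :
    ∀ᵐ t, h t = w t → DifferentiableAt ℝ h t → DifferentiableAt ℝ w t → deriv h t = deriv w t := by
  filter_upwards [ae_deriv_eq_zero_of_eq_zero (h - w)] with t ht e dh dw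
  have := ht (by simp [e])
  rw [deriv_sub dh dw] at this
  linarith

theorem absolutelyContinuousOnInterval_of_dist_le {h : ℝ → ℝ} {K : ℝ → ℝ} {l : ℝ} (hl : 0 ≤ l)
    (hK : AbsolutelyContinuousOnInterval K 0 l)
    (H : ∀ s t, 0 ≤ s → s ≤ t → t ≤ l → dist (h s) (h t) ≤ dist (K s) (K t)) :
    AbsolutelyContinuousOnInterval h 0 l := by
  rw [absolutelyContinuousOnInterval_iff] at hK ⊢
  intro ε hε
  obtain ⟨δ, hδ, hd⟩ := hK ε hε
  refine ⟨δ, hδ, fun E hE hlt => lt_of_le_of_lt (Finset.sum_le_sum fun i hi => ?_) (hd E hE hlt)⟩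
  obtain ⟨h1, h2⟩ := hE.1 i hi
  rw [uIcc_of_le hl] at h1 h2
  rcases le_total (E.2 i).1 (E.2 i).2 with hle | hle
  · exact H _ _ h1.1 hle h2.2
  · rw [dist_comm, dist_comm (K _)]
    exact H _ _ h2.1 hle h1.2

/-- The increments of `h` are bounded by those of the primitive `K` of `k`, which is absolutely
continuous. Comparing difference quotients where both functions are differentiable gives the bound
on the derivative. -/
theorem ac_of_le_lintegral {h : ℝ → ℝ} {k : ℝ → ℝ≥0∞} {l : ℝ} (hl : 0 ≤ l)
    (hm : AEMeasurable k (volume.restrict (Icc 0 l))) (hk : ∫⁻ t in Icc 0 l, k t ≠ ∞)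
    (H : ∀ s t, 0 ≤ s → s ≤ t → t ≤ l →
      ENNReal.ofReal |h s - h t| ≤ ∫⁻ τ in Icc s t, k τ) :
    AbsolutelyContinuousOnInterval h 0 l ∧
      ∀ᵐ t ∂volume.restrict (Icc 0 l), ‖deriv h t‖ₑ ≤ k t := by
  have hint : IntervalIntegrable (fun t => (k t).toReal) volume 0 l := by
    rw [intervalIntegrable_iff_integrableOn_Icc_of_le hl]
    exact integrable_toReal_of_lintegral_ne_top hm hk
  set K : ℝ → ℝ := fun x => ∫ τ in (0 : ℝ)..x, (k τ).toReal with hKdef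
  have hKac : AbsolutelyContinuousOnInterval K 0 l :=
    hint.absolutelyContinuousOnInterval_intervalIntegral (by simp)
  have hKdiff : ∀ s t, 0 ≤ s → s ≤ t → t ≤ l →
      K t - K s = (∫⁻ τ in Icc s t, k τ).toReal := by
    intro s t hs hst ht
    have hst' : Icc s t ⊆ Icc 0 l := Icc_subset_Icc hs ht
    have i1 : IntervalIntegrable (fun t => (k t).toReal) volume 0 s :=
      hint.mono_set (by rw [uIcc_of_le hs, uIcc_of_le hl]; exact Icc_subset_Icc le_rfl (hst.trans ht))
    have i2 : IntervalIntegrable (fun t => (k t).toReal) volume 0 t :=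
      hint.mono_set (by
        rw [uIcc_of_le (hs.trans hst), uIcc_of_le hl]; exact Icc_subset_Icc le_rfl ht)
    rw [hKdef]
    simp only
    rw [intervalIntegral.integral_interval_sub_left i2 i1, intervalIntegral.integral_of_le hst,
      ← integral_Icc_eq_integral_Ioc, integral_toReal (hm.mono_measure
        (Measure.restrict_mono hst' le_rfl))]
    have := ae_lt_top' hm hk
    exact ae_mono (Measure.restrict_mono hst' le_rfl) this
  have hdist : ∀ s t, 0 ≤ s → s ≤ t → t ≤ l → |h s - h t| ≤ K t - K s := by
    intro s t hs hst ht
    rw [hKdiff s t hs hst ht]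
    have hne : ∫⁻ τ in Icc s t, k τ ≠ ∞ :=
      ne_top_of_le_ne_top hk (lintegral_mono_set (Icc_subset_Icc hs ht))
    exact (ENNReal.ofReal_le_iff_le_toReal hne).1 (H s t hs hst ht)
  have hac : AbsolutelyContinuousOnInterval h 0 l := by
    refine absolutelyContinuousOnInterval_of_dist_le hl hKac fun s t hs hst ht => ?_
    rw [Real.dist_eq, Real.dist_eq, abs_sub_comm (K s)]
    exact (hdist s t hs hst ht).trans (le_abs_self _)
  refine ⟨hac, ?_⟩
  rw [ae_restrict_iff' measurableSet_Icc]
  have h0 : ∀ᵐ t : ℝ, t ≠ 0 := by simp [ae_iff, measure_singleton]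
  have h1 : ∀ᵐ t : ℝ, t ≠ l := by simp [ae_iff, measure_singleton]
  have h2 := hint.ae_hasDerivAt_integral
  rw [uIcc_of_le hl] at h2
  filter_upwards [hac.ae_differentiableAt, h0, h1, h2] with t ht ht0 htl htK htm
  have dh := (ht (by rwa [uIcc_of_le hl])).hasDerivAt
  have dK := htK htm 0 ⟨le_rfl, hl⟩
  have hle : |deriv h t| ≤ (k t).toReal := by
    have s1 := (hasDerivAt_iff_tendsto_slope.1 dh).abs
    have s2 := hasDerivAt_iff_tendsto_slope.1 dK
    have hmem : ∀ᶠ y in 𝓝[≠] t, y ∈ Icc 0 l :=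
      nhdsWithin_le_nhds (Icc_mem_nhds (lt_of_le_of_ne htm.1 ht0.symm) (lt_of_le_of_ne htm.2 htl))
    refine le_of_tendsto_of_tendsto s1 s2 ?_
    filter_upwards [hmem, self_mem_nhdsWithin] with y hy hne
    simp only [slope_def_field]
    rw [abs_div]
    rcases lt_or_gt_of_ne hne with hlt | hgt
    · have := hdist y t hy.1 hlt.le htm.2
      rw [abs_of_neg (sub_neg.2 hlt), div_neg, ← neg_div, ← neg_div_neg_eq, neg_neg]
      rw [show (K y - K t) / (y - t) = (K t - K y) / -(y - t) by rw [← neg_div_neg_eq]; ring_nf]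
      exact div_le_div_of_nonneg_right this (by linarith)
    · have := hdist t y htm.1 hgt.le hy.2
      rw [abs_of_pos (sub_pos.2 hgt), abs_sub_comm]
      exact div_le_div_of_nonneg_right this (by linarith [show t < y from hgt])
  rw [← ofReal_norm, Real.norm_eq_abs]
  exact ENNReal.ofReal_le_of_le_toReal hle

/-- Converse of `ac_of_le_lintegral`, from the fundamental theorem of calculus. Together they
exchange upper gradient inequalities on all subintervals for a pointwise a.e. bound. -/
theorem le_lintegral_of_ac {h : ℝ → ℝ} {k : ℝ → ℝ≥0∞} {l : ℝ}
    (hac : AbsolutelyContinuousOnInterval h 0 l)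
    (hd : ∀ᵐ t ∂volume.restrict (Icc 0 l), ‖deriv h t‖ₑ ≤ k t)
    {s t : ℝ} (hs : 0 ≤ s) (hst : s ≤ t) (ht : t ≤ l) :
    ENNReal.ofReal |h s - h t| ≤ ∫⁻ τ in Icc s t, k τ := by
  have hsub : Icc s t ⊆ Icc 0 l := Icc_subset_Icc hs ht
  have hac' : AbsolutelyContinuousOnInterval h s t :=
    hac.mono (by rwa [uIcc_of_le hst, uIcc_of_le (hs.trans (hst.trans ht))])
  rw [abs_sub_comm, ← hac'.integral_deriv_eq_sub, intervalIntegral.integral_of_le hst,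
    ← integral_Icc_eq_integral_Ioc, ← Real.norm_eq_abs, ofReal_norm]
  refine (enorm_integral_le_lintegral_enorm _).trans (lintegral_mono_ae ?_)
  exact ae_mono (Measure.restrict_mono hsub le_rfl) hd

/-! ### Curves -/

section Curves

variable {X : Type*} [MetricSpace X]

theorem Curve.edist_le (γ : Curve X) {s t : ℝ} (hs : 0 ≤ s) (hst : s ≤ t) (ht : t ≤ γ.length) :
    edist (γ.toFun s) (γ.toFun t) ≤ ENNReal.ofReal (t - s) := by
  have h1 : s ∈ Icc 0 γ.length := ⟨hs, hst.trans ht⟩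
  have h2 : t ∈ Icc 0 γ.length := ⟨hs.trans hst, ht⟩
  have := γ.unitSpeed h1 h2
  rw [NNReal.coe_one, one_mul] at this
  rw [← this]
  exact eVariationOn.edist_le _ ⟨h1, le_rfl, hst⟩ ⟨h2, hst, le_rfl⟩

theorem Curve.dist_le (γ : Curve X) {s t : ℝ} (hs : s ∈ Icc 0 γ.length) (ht : t ∈ Icc 0 γ.length) :
    dist (γ.toFun s) (γ.toFun t) ≤ |s - t| := by
  wlog hst : s ≤ t generalizing s t
  · rw [dist_comm, abs_sub_comm]
    exact this ht hs (le_of_not_ge hst)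
  have := γ.edist_le hs.1 hst ht.2
  rw [edist_dist, ENNReal.ofReal_le_ofReal_iff (by linarith)] at this
  rwa [abs_sub_comm, abs_of_nonneg (by linarith)]

theorem Curve.continuousOn (γ : Curve X) : ContinuousOn γ.toFun (Icc 0 γ.length) := by
  have : LipschitzOnWith 1 γ.toFun (Icc 0 γ.length) :=
    LipschitzOnWith.of_dist_le_mul fun x hx y hy => by
      simpa [Real.dist_eq] using γ.dist_le hx hy
  exact this.continuousOn

theorem Curve.aemeasurable [MeasurableSpace X] [BorelSpace X] (γ : Curve X) :
    AEMeasurable γ.toFun (volume.restrict (Icc 0 γ.length)) :=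
  γ.continuousOn.aemeasurable measurableSet_Icc

/-- The restriction of a curve to a subinterval. -/
def Curve.sub (γ : Curve X) (s t : ℝ) (hs : 0 ≤ s) (hst : s < t) (ht : t ≤ γ.length) :
    Curve X where
  toFun τ := γ.toFun (s + τ)
  length := t - s
  length_pos := sub_pos.2 hst
  unitSpeed := by
    intro x hx y hy
    have hx' : s + x ∈ Icc 0 γ.length := ⟨by linarith [hx.1], by linarith [hx.2]⟩
    have hy' : s + y ∈ Icc 0 γ.length := ⟨by linarith [hy.1], by linarith [hy.2]⟩
    have := γ.unitSpeed hx' hy'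
    rw [show s + y - (s + x) = y - x by ring] at this
    rw [← this]
    have himg : (fun τ => s + τ) '' (Icc 0 (t - s) ∩ Icc x y) =
        Icc 0 γ.length ∩ Icc (s + x) (s + y) := by
      ext z
      constructor
      · rintro ⟨τ, ⟨h1, h2⟩, rfl⟩
        exact ⟨⟨by linarith [h1.1], by linarith [h1.2]⟩, by linarith [h2.1], by linarith [h2.2]⟩
      · rintro ⟨h1, h2⟩
        refine ⟨z - s, ⟨⟨?_, ?_⟩, ?_, ?_⟩, by simp⟩ <;>
          linarith [h1.1, h1.2, h2.1, h2.2, hx.1, hx.2, hy.1, hy.2]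
    rw [← himg]
    exact eVariationOn.comp_eq_of_monotoneOn γ.toFun (fun τ => s + τ)
      (fun a _ b _ hab => by simpa using hab)

@[simp] theorem Curve.sub_toFun (γ : Curve X) (s t : ℝ) (hs : 0 ≤ s) (hst : s < t)
    (ht : t ≤ γ.length) (τ : ℝ) : (γ.sub s t hs hst ht).toFun τ = γ.toFun (s + τ) := rfl

@[simp] theorem Curve.sub_length (γ : Curve X) (s t : ℝ) (hs : 0 ≤ s) (hst : s < t)
    (ht : t ≤ γ.length) : (γ.sub s t hs hst ht).length = t - s := rfl

theorem Curve.sub_integral (γ : Curve X) (s t : ℝ) (hs : 0 ≤ s) (hst : s < t)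
    (ht : t ≤ γ.length) (g : X → ℝ≥0∞) :
    (γ.sub s t hs hst ht).integral g = ∫⁻ τ in Icc s t, g (γ.toFun τ) := by
  unfold Curve.integral
  simp only [Curve.sub_toFun, Curve.sub_length]
  have hmp := measurePreserving_add_left (volume : Measure ℝ) s
  have := hmp.setLIntegral_comp_preimage_emb (MeasurableEquiv.addLeft s).measurableEmbedding
    (fun τ => g (γ.toFun τ)) (Icc s t)
  rw [← this]
  simp

theorem Curve.sub_integral_le (γ : Curve X) (s t : ℝ) (hs : 0 ≤ s) (hst : s < t)
    (ht : t ≤ γ.length) (g : X → ℝ≥0∞) :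
    (γ.sub s t hs hst ht).integral g ≤ γ.integral g := by
  rw [Curve.sub_integral]
  exact lintegral_mono_set (Icc_subset_Icc hs ht)

theorem Curve.IsIn.sub {γ : Curve X} {E : Set X} (h : γ.IsIn E) (s t : ℝ) (hs : 0 ≤ s) (hst : s < t)
    (ht : t ≤ γ.length) : (γ.sub s t hs hst ht).IsIn E := fun τ hτ =>
  h _ ⟨by linarith [hτ.1], by
    have := hτ.2
    simp only [Curve.sub_length] at this
    linarith⟩

theorem Curve.integral_mono (γ : Curve X) {g g' : X → ℝ≥0∞} (h : ∀ x, g x ≤ g' x) :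
    γ.integral g ≤ γ.integral g' :=
  lintegral_mono fun _ => h _

end Curves

/-! ### The filter of `p`-almost every curve -/

section Modulus

variable {X : Type*} [MetricSpace X] [MeasurableSpace X] {μ : Measure X} {p : ℝ}

/-- The filter of properties that hold for `p`-almost every curve. -/
noncomputable def curveFilter (μ : Measure X) (p : ℝ) : Filter (Curve X) :=
  ⨅ ρ ∈ {ρ : X → ℝ≥0∞ | Measurable ρ ∧ ∫⁻ x, ρ x ^ p ∂μ < ∞}, 𝓟 {γ | γ.integral ρ < ∞}

theorem max_rpow_le_add (p : ℝ) (a b : ℝ≥0∞) : max a b ^ p ≤ a ^ p + b ^ p := by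
  rcases le_total a b with h | h
  · rw [max_eq_right h]; exact le_add_self
  · rw [max_eq_left h]; exact le_self_add

/-- The maximum of two `L^p` densities is again one, so the defining sets of the filter form a basis
and a single density witnesses each property. -/
theorem eventually_curveFilter_iff (hp : 0 < p) {P : Curve X → Prop} :
    (∀ᶠ γ in curveFilter μ p, P γ) ↔
      ∃ ρ : X → ℝ≥0∞, Measurable ρ ∧ ∫⁻ x, ρ x ^ p ∂μ < ∞ ∧
        ∀ γ : Curve X, γ.integral ρ < ∞ → P γ := by
  have hb : (curveFilter μ p).HasBasis
      (fun ρ => ρ ∈ {ρ : X → ℝ≥0∞ | Measurable ρ ∧ ∫⁻ x, ρ x ^ p ∂μ < ∞})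
      (fun ρ => {γ : Curve X | γ.integral ρ < ∞}) := by
    refine hasBasis_biInf_principal ?_ ⟨0, measurable_zero, by simp [hp]⟩
    rintro ρ ⟨hρ, hρi⟩ σ ⟨hσ, hσi⟩
    refine ⟨fun x => max (ρ x) (σ x), ⟨hρ.max hσ, ?_⟩, ?_, ?_⟩
    · calc ∫⁻ x, max (ρ x) (σ x) ^ p ∂μ ≤ ∫⁻ x, (ρ x ^ p + σ x ^ p) ∂μ :=
            lintegral_mono fun x => max_rpow_le_add p _ _
        _ = ∫⁻ x, ρ x ^ p ∂μ + ∫⁻ x, σ x ^ p ∂μ := lintegral_add_left (hρ.pow_const p) _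
        _ < ∞ := ENNReal.add_lt_top.2 ⟨hρi, hσi⟩
    · exact fun γ hγ => lt_of_le_of_lt (γ.integral_mono fun x => le_max_left _ _) hγ
    · exact fun γ hγ => lt_of_le_of_lt (γ.integral_mono fun x => le_max_right _ _) hγ
  rw [hb.eventually_iff]
  simp only [mem_ofPred_eq, and_assoc]

/-- Countably many `L^p` densities are dominated, up to factors, by a single one. -/
theorem exists_dominating_density (hp : 0 < p) (ρ : ℕ → X → ℝ≥0∞) (hm : ∀ n, Measurable (ρ n))
    (hi : ∀ n, ∫⁻ x, ρ n x ^ p ∂μ < ∞) :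
    ∃ σ : X → ℝ≥0∞, Measurable σ ∧ ∫⁻ x, σ x ^ p ∂μ < ∞ ∧
      ∀ γ : Curve X, γ.integral σ < ∞ → ∀ n, γ.integral (ρ n) < ∞ := by
  obtain ⟨b, hb0, hb⟩ := ENNReal.exists_pos_tsum_mul_lt_of_countable one_ne_zero
    (fun n => ∫⁻ x, ρ n x ^ p ∂μ) (fun n => (hi n).ne)
  have hpow : ∀ n x, ((b n : ℝ≥0∞) ^ (1 / p) * ρ n x) ^ p = b n * ρ n x ^ p := by
    intro n x
    rw [ENNReal.mul_rpow_of_nonneg _ _ hp.le, ← ENNReal.rpow_mul, one_div_mul_cancel hp.ne',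
      ENNReal.rpow_one]
  refine ⟨fun x => ⨆ n, (b n : ℝ≥0∞) ^ (1 / p) * ρ n x,
    .iSup fun n => (hm n).const_mul _, ?_, ?_⟩
  · calc ∫⁻ x, (⨆ n, (b n : ℝ≥0∞) ^ (1 / p) * ρ n x) ^ p ∂μ
        ≤ ∫⁻ x, ∑' n, b n * ρ n x ^ p ∂μ := by
          refine lintegral_mono fun x => ?_
          rw [← ENNReal.le_rpow_inv_iff hp]
          refine iSup_le fun n => ?_
          rw [ENNReal.le_rpow_inv_iff hp, hpow]
          exact ENNReal.le_tsum n
      _ = ∑' n, ∫⁻ x, b n * ρ n x ^ p ∂μ :=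
          lintegral_tsum fun n => (((hm n).pow_const p).const_mul _).aemeasurable
      _ = ∑' n, (∫⁻ x, ρ n x ^ p ∂μ) * b n := by
          congr 1; ext n
          rw [lintegral_const_mul _ ((hm n).pow_const p), mul_comm]
      _ < ∞ := hb.trans ENNReal.one_lt_top
  · intro γ hγ n
    have hbpos : (b n : ℝ≥0∞) ^ (1 / p) ≠ 0 := by
      simp [ENNReal.rpow_eq_zero_iff, (hb0 n).ne', hp.not_gt]
    have hbtop : (b n : ℝ≥0∞) ^ (1 / p) ≠ ∞ :=
      ENNReal.rpow_ne_top_of_nonneg (by positivity) ENNReal.coe_ne_top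
    have h1 : (b n : ℝ≥0∞) ^ (1 / p) * γ.integral (ρ n) < ∞ := by
      refine lt_of_le_of_lt ?_ hγ
      unfold Curve.integral
      rw [← lintegral_const_mul' _ _ hbtop]
      exact lintegral_mono fun t => le_iSup (fun n => (b n : ℝ≥0∞) ^ (1 / p) * ρ n (γ.toFun t)) n
    exact lt_top_iff_ne_top.2 fun h => h1.ne (by rw [h, ENNReal.mul_top hbpos])

theorem countableInterFilter_curveFilter (hp : 0 < p) :
    CountableInterFilter (curveFilter (X := X) μ p) := by
  refine ⟨fun S hS hmem => ?_⟩
  rcases S.eq_empty_or_nonempty with rfl | hne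
  · simp
  obtain ⟨f, rfl⟩ := hS.exists_eq_range hne
  have : ∀ n, ∀ᶠ γ in curveFilter μ p, γ ∈ f n := fun n => hmem _ ⟨n, rfl⟩
  choose ρ hρ using fun n => (eventually_curveFilter_iff hp).1 (this n)
  obtain ⟨σ, hσm, hσi, hσ⟩ := exists_dominating_density hp ρ (fun n => (hρ n).1)
    (fun n => (hρ n).2.1)
  have hev : ∀ᶠ γ in curveFilter μ p, ∀ n, γ ∈ f n :=
    (eventually_curveFilter_iff hp).2 ⟨σ, hσm, hσi, fun γ hγ n => (hρ n).2.2 γ (hσ γ hγ n)⟩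
  filter_upwards [hev] with γ hγ
  rintro _ ⟨n, rfl⟩
  exact hγ n

/-- Fuglede's characterization of exceptional families. Given modulus zero, admissible `ρ n` with
tiny norms combine into the supremum of `(n + 1) * ρ n`, which lies in `L^p` and has infinite
integral along every exceptional curve. Conversely, a density with infinite integral along these
curves stays admissible after multiplication by `1 / (n + 1)`. -/
theorem modulus_eq_zero_iff (hp : 0 < p) {P : Curve X → Prop} :
    modulus μ p {γ | ¬ P γ} = 0 ↔ ∀ᶠ γ in curveFilter μ p, P γ := by
  constructor
  · intro h
    have hex : ∀ n : ℕ, ∃ ρ : X → ℝ≥0∞, Measurable ρ ∧ (∀ γ : Curve X, ¬ P γ → 1 ≤ γ.integral ρ) ∧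
        ∫⁻ x, ρ x ^ p ∂μ < (2⁻¹) ^ n / ((n : ℝ≥0∞) + 1) ^ p := by
      intro n
      have hpos : 0 < (2⁻¹ : ℝ≥0∞) ^ n / ((n : ℝ≥0∞) + 1) ^ p := by
        refine ENNReal.div_pos (by simp) (ENNReal.rpow_ne_top_of_nonneg hp.le ?_)
        exact ENNReal.add_ne_top.2 ⟨ENNReal.natCast_ne_top n, ENNReal.one_ne_top⟩
      rw [← h] at hpos
      unfold modulus at hpos
      simp only [iInf_lt_iff, mem_ofPred_eq] at hpos
      obtain ⟨ρ, h1, h2, h3⟩ := hpos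
      exact ⟨ρ, h1, h2, h3⟩
    choose ρ hm h1 hlt using hex
    refine (eventually_curveFilter_iff hp).2 ⟨fun x => ⨆ n : ℕ, ((n : ℝ≥0∞) + 1) * ρ n x,
      .iSup fun n => (hm n).const_mul _, ?_, ?_⟩
    · calc ∫⁻ x, (⨆ n : ℕ, ((n : ℝ≥0∞) + 1) * ρ n x) ^ p ∂μ
          ≤ ∫⁻ x, ∑' n : ℕ, ((n : ℝ≥0∞) + 1) ^ p * ρ n x ^ p ∂μ := by
            refine lintegral_mono fun x => ?_
            rw [← ENNReal.le_rpow_inv_iff hp]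
            refine iSup_le fun n => ?_
            rw [ENNReal.le_rpow_inv_iff hp, ENNReal.mul_rpow_of_nonneg _ _ hp.le]
            exact ENNReal.le_tsum (f := fun n : ℕ => ((n : ℝ≥0∞) + 1) ^ p * ρ n x ^ p) n
        _ = ∑' n : ℕ, ∫⁻ x, ((n : ℝ≥0∞) + 1) ^ p * ρ n x ^ p ∂μ :=
            lintegral_tsum fun n => (((hm n).pow_const p).const_mul _).aemeasurable
        _ = ∑' n : ℕ, ((n : ℝ≥0∞) + 1) ^ p * ∫⁻ x, ρ n x ^ p ∂μ := by
            congr 1; ext n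
            rw [lintegral_const_mul _ ((hm n).pow_const p)]
        _ ≤ ∑' n : ℕ, (2⁻¹ : ℝ≥0∞) ^ n := by
            refine ENNReal.tsum_le_tsum fun n => ?_
            refine (mul_le_mul_right (hlt n).le _).trans ENNReal.mul_div_le
        _ < ∞ := by
            rw [ENNReal.tsum_geometric, ENNReal.one_sub_inv_two, inv_inv]
            exact ENNReal.ofNat_lt_top
    · intro γ hγ
      by_contra hP
      refine hγ.ne (ENNReal.eq_top_of_forall_nnreal_le fun r => ?_)
      obtain ⟨n, hn⟩ := exists_nat_ge r
      calc (r : ℝ≥0∞) ≤ (n : ℝ≥0∞) + 1 := by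
            refine le_trans ?_ le_self_add
            exact_mod_cast hn
        _ ≤ ((n : ℝ≥0∞) + 1) * γ.integral (ρ n) := le_mul_of_one_le_right' (h1 n γ hP)
        _ = ∫⁻ t in Icc 0 γ.length, ((n : ℝ≥0∞) + 1) * ρ n (γ.toFun t) := by
            unfold Curve.integral
            rw [lintegral_const_mul']
            exact ENNReal.add_ne_top.2 ⟨ENNReal.natCast_ne_top n, ENNReal.one_ne_top⟩
        _ ≤ _ := lintegral_mono fun t =>
            le_iSup (fun n : ℕ => ((n : ℝ≥0∞) + 1) * ρ n (γ.toFun t)) n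
  · intro h
    obtain ⟨ρ, hm, hi, hρ⟩ := (eventually_curveFilter_iff hp).1 h
    refine le_antisymm ?_ bot_le
    refine ge_of_tendsto' (x := atTop) (f := fun n : ℕ =>
      (((n : ℝ≥0∞) + 1)⁻¹) ^ p * ∫⁻ x, ρ x ^ p ∂μ) ?_ fun n => ?_
    · have h1 : Tendsto (fun n : ℕ => ((n : ℝ≥0∞) + 1)⁻¹) atTop (𝓝 0) := by
        have := (tendsto_add_atTop_iff_nat 1).2 ENNReal.tendsto_inv_nat_nhds_zero
        simpa using this
      have h2 := (ENNReal.continuous_rpow_const (y := p)).tendsto 0 |>.comp h1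
      rw [ENNReal.zero_rpow_of_pos hp] at h2
      have h3 := ENNReal.Tendsto.mul_const (b := ∫⁻ x, ρ x ^ p ∂μ) h2 (Or.inr hi.ne)
      simpa using h3
    · unfold modulus
      have hne : ((n : ℝ≥0∞) + 1)⁻¹ ≠ 0 :=
        ENNReal.inv_ne_zero.2 (ENNReal.add_ne_top.2 ⟨ENNReal.natCast_ne_top n, ENNReal.one_ne_top⟩)
      have hnt : ((n : ℝ≥0∞) + 1)⁻¹ ≠ ∞ := ENNReal.inv_ne_top.2 (by simp)
      refine (iInf₂_le_of_le (fun x => ((n : ℝ≥0∞) + 1)⁻¹ * ρ x) (hm.const_mul _)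
        (iInf_le_of_le ?_ le_rfl)).trans ?_
      · intro γ hγ
        have : γ.integral ρ = ∞ := by
          by_contra hne'
          exact hγ (hρ γ (lt_top_iff_ne_top.2 hne'))
        unfold Curve.integral at this ⊢
        rw [lintegral_const_mul' _ _ hnt, this, ENNReal.mul_top hne]
        exact le_top
      · rw [← lintegral_const_mul _ (hm.pow_const p)]
        exact lintegral_mono fun x => (ENNReal.mul_rpow_of_nonneg _ _ hp.le).le

/-- A property of `p`-almost every curve holds for all subcurves of `p`-almost every curve. -/
theorem eventually_sub (hp : 0 < p) {P : Curve X → Prop} (h : ∀ᶠ γ in curveFilter μ p, P γ) :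
    ∀ᶠ γ in curveFilter μ p, ∀ s t hs hst ht, P (γ.sub s t hs hst ht) := by
  obtain ⟨ρ, hm, hi, hρ⟩ := (eventually_curveFilter_iff hp).1 h
  exact (eventually_curveFilter_iff hp).2 ⟨ρ, hm, hi, fun γ hγ s t hs hst ht =>
    hρ _ (lt_of_le_of_lt (γ.sub_integral_le s t hs hst ht ρ) hγ)⟩

theorem eventually_integral_lt_top (hp : 0 < p) {ρ : X → ℝ≥0∞} (hm : Measurable ρ)
    (hi : ∫⁻ x, ρ x ^ p ∂μ < ∞) : ∀ᶠ γ in curveFilter μ p, γ.integral ρ < ∞ :=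
  (eventually_curveFilter_iff hp).2 ⟨ρ, hm, hi, fun _ h => h⟩

variable [BorelSpace X]

/-- Along `p`-almost every curve, a property valid almost everywhere holds almost everywhere. -/
theorem eventually_ae_of_ae (hp : 0 < p) {Q : X → Prop} (h : ∀ᵐ x ∂μ, Q x) :
    ∀ᶠ γ in curveFilter μ p, ∀ᵐ t ∂volume.restrict (Icc 0 γ.length), Q (γ.toFun t) := by
  obtain ⟨N, hQN, hN, hN0⟩ := exists_measurable_superset_of_null (ae_iff.1 h)
  have hm : Measurable (N.indicator fun _ => (∞ : ℝ≥0∞)) := measurable_const.indicator hN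
  have hi : ∫⁻ x, N.indicator (fun _ => (∞ : ℝ≥0∞)) x ^ p ∂μ < ∞ := by
    have : ∫⁻ x, N.indicator (fun _ => (∞ : ℝ≥0∞)) x ^ p ∂μ = 0 := by
      rw [lintegral_eq_zero_iff (hm.pow_const p)]
      filter_upwards [measure_eq_zero_iff_ae_notMem.1 hN0] with x hx
      simp [hx, hp]
    simp [this]
  filter_upwards [eventually_integral_lt_top hp hm hi] with γ hγ
  unfold Curve.integral at hγ
  have := ae_lt_top' (hm.comp_aemeasurable γ.aemeasurable) hγ.ne
  filter_upwards [this] with t ht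
  by_contra hQ
  have : γ.toFun t ∈ N := hQN hQ
  simp [this] at ht

theorem eventually_ae_of_ae_restrict (hp : 0 < p) {E : Set X} (hE : MeasurableSet E) {Q : X → Prop}
    (h : ∀ᵐ x ∂μ.restrict E, Q x) :
    ∀ᶠ γ in curveFilter μ p, γ.IsIn E →
      ∀ᵐ t ∂volume.restrict (Icc 0 γ.length), Q (γ.toFun t) := by
  filter_upwards [eventually_ae_of_ae hp ((ae_restrict_iff' hE).1 h)] with γ hγ hin
  filter_upwards [hγ, ae_restrict_mem measurableSet_Icc] with t ht htm using ht (hin t htm)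

/-- A Borel representative of `g`, set to zero outside `E`, is a density on `X` that agrees with `g`
a.e. along almost every curve in `E`. -/
theorem eventually_integrable (hp : 0 < p) {E : Set X} (hE : MeasurableSet E) {g : X → ℝ≥0∞}
    (hg : AEMeasurable g (μ.restrict E)) (hi : ∫⁻ x in E, g x ^ p ∂μ < ∞) :
    ∀ᶠ γ in curveFilter μ p, γ.IsIn E →
      AEMeasurable (fun t => g (γ.toFun t)) (volume.restrict (Icc 0 γ.length)) ∧
        γ.integral g < ∞ := by
  have hm' : Measurable (E.indicator (hg.mk g)) := hg.measurable_mk.indicator hE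
  have hi' : ∫⁻ x, E.indicator (hg.mk g) x ^ p ∂μ < ∞ := by
    have : ∀ x, E.indicator (hg.mk g) x ^ p = E.indicator (fun x => hg.mk g x ^ p) x := by
      intro x
      by_cases hx : x ∈ E <;> simp [hx, hp]
    simp_rw [this]
    rw [lintegral_indicator hE]
    refine lt_of_le_of_lt (lintegral_mono_ae ?_) hi
    filter_upwards [hg.ae_eq_mk] with x hx
    rw [hx]
  filter_upwards [eventually_ae_of_ae_restrict hp hE hg.ae_eq_mk,
    eventually_integral_lt_top hp hm' hi'] with γ h1 h2 hin
  have h3 := h1 hin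
  have h4 : ∀ᵐ t ∂volume.restrict (Icc 0 γ.length),
      g (γ.toFun t) = E.indicator (hg.mk g) (γ.toFun t) := by
    filter_upwards [h3, ae_restrict_mem measurableSet_Icc] with t ht htm
    rw [indicator_of_mem (hin t htm), ht]
  refine ⟨(hm'.comp_aemeasurable γ.aemeasurable).congr ?_, ?_⟩
  · filter_upwards [h4] with t ht using ht.symm
  · unfold Curve.integral at h2 ⊢
    rwa [lintegral_congr_ae h4]

end Modulus

/-! ### Weak upper gradients and absolute continuity along curves -/

section Gradients

variable {X : Type*} [MetricSpace X]

theorem gap_of_ne {a b : EReal} (ha : a ≠ ⊤ ∧ a ≠ ⊥) (hb : b ≠ ⊤ ∧ b ≠ ⊥) :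
    gap a b = ENNReal.ofReal |a.toReal - b.toReal| := if_pos ⟨ha, hb⟩

theorem ne_of_gap_ne_top {a b : EReal} (h : gap a b ≠ ∞) : (a ≠ ⊤ ∧ a ≠ ⊥) ∧ (b ≠ ⊤ ∧ b ≠ ⊥) := by
  by_contra hn
  exact h (if_neg hn)

/-- The function `u` is finite on the curve `γ`, absolutely continuous along it, and its derivative
is bounded by `g`. -/
structure ACBound (γ : Curve X) (u : X → EReal) (g : X → ℝ≥0∞) : Prop where
  finite : ∀ t ∈ Icc 0 γ.length, u (γ.toFun t) ≠ ⊤ ∧ u (γ.toFun t) ≠ ⊥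
  ac : AbsolutelyContinuousOnInterval (fun t => (u (γ.toFun t)).toReal) 0 γ.length
  deriv_le : ∀ᵐ t ∂volume.restrict (Icc 0 γ.length),
    ‖deriv (fun t => (u (γ.toFun t)).toReal) t‖ₑ ≤ g (γ.toFun t)

theorem ACBound.le_lintegral {γ : Curve X} {u : X → EReal} {g : X → ℝ≥0∞} (h : ACBound γ u g)
    {s t : ℝ} (hs : 0 ≤ s) (hst : s ≤ t) (ht : t ≤ γ.length) :
    ENNReal.ofReal |(u (γ.toFun s)).toReal - (u (γ.toFun t)).toReal| ≤
      ∫⁻ τ in Icc s t, g (γ.toFun τ) :=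
  le_lintegral_of_ac h.ac h.deriv_le hs hst ht

theorem ACBound.upperGradientIneq {γ : Curve X} {u : X → EReal} {g : X → ℝ≥0∞}
    (h : ACBound γ u g) : UpperGradientIneq u g γ := by
  unfold UpperGradientIneq
  rw [gap_of_ne (h.finite 0 ⟨le_rfl, γ.length_pos.le⟩) (h.finite _ ⟨γ.length_pos.le, le_rfl⟩)]
  exact h.le_lintegral le_rfl γ.length_pos.le le_rfl

theorem ACBound.ae_differentiableAt {γ : Curve X} {u : X → EReal} {g : X → ℝ≥0∞}
    (h : ACBound γ u g) : ∀ᵐ t ∂volume.restrict (Icc 0 γ.length),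
      DifferentiableAt ℝ (fun t => (u (γ.toFun t)).toReal) t := by
  rw [ae_restrict_iff' measurableSet_Icc]
  have := h.ac.ae_differentiableAt
  rwa [uIcc_of_le γ.length_pos.le] at this

/-- If the upper gradient inequality holds along all subcurves and the curve integral is finite,
then the function is absolutely continuous along the curve. -/
theorem acBound_of_sub {γ : Curve X} {u : X → EReal} {g : X → ℝ≥0∞}
    (hm : AEMeasurable (fun t => g (γ.toFun t)) (volume.restrict (Icc 0 γ.length)))
    (hi : γ.integral g < ∞)
    (h : ∀ s t hs hst ht, UpperGradientIneq u g (γ.sub s t hs hst ht)) : ACBound γ u g := by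
  have key : ∀ s t, 0 ≤ s → s < t → t ≤ γ.length →
      gap (u (γ.toFun s)) (u (γ.toFun t)) ≤ ∫⁻ τ in Icc s t, g (γ.toFun τ) := by
    intro s t hs hst ht
    have := h s t hs hst ht
    unfold UpperGradientIneq at this
    rw [Curve.sub_integral] at this
    simpa using this
  have keyfin : ∀ s t, 0 ≤ s → s < t → t ≤ γ.length → gap (u (γ.toFun s)) (u (γ.toFun t)) ≠ ∞ :=
    fun s t hs hst ht => ne_top_of_le_ne_top hi.ne
      ((key s t hs hst ht).trans (lintegral_mono_set (Icc_subset_Icc hs ht)))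
  have hfin : ∀ t ∈ Icc 0 γ.length, u (γ.toFun t) ≠ ⊤ ∧ u (γ.toFun t) ≠ ⊥ := by
    intro t ht
    rcases lt_or_eq_of_le ht.2 with hlt | rfl
    · exact (ne_of_gap_ne_top (keyfin t _ ht.1 hlt le_rfl)).1
    · exact (ne_of_gap_ne_top (keyfin 0 _ le_rfl γ.length_pos le_rfl)).2
  have hac := ac_of_le_lintegral (h := fun t => (u (γ.toFun t)).toReal) γ.length_pos.le hm hi.ne
    (by
      intro s t hs hst ht
      rcases hst.eq_or_lt with rfl | hlt
      · simp
      · rw [← gap_of_ne (hfin s ⟨hs, hst.trans ht⟩) (hfin t ⟨hs.trans hst, ht⟩)]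
        exact key s t hs hlt ht)
  exact ⟨hfin, hac.1, hac.2⟩

variable [MeasurableSpace X] {μ : Measure X} {p : ℝ} {E : Set X} {u : X → EReal}
  {g g' : X → ℝ≥0∞}

theorem weakUpperGradient_modulus_iff (hp : 0 < p) :
    modulus μ p {γ : Curve X | γ.IsIn E ∧ ¬ UpperGradientIneq u g γ} = 0 ↔
      ∀ᶠ γ in curveFilter μ p, γ.IsIn E → UpperGradientIneq u g γ := by
  rw [← modulus_eq_zero_iff hp]
  simp only [Classical.not_imp]

theorem IsUpperGradient.isWeakUpperGradient (hp : 0 < p) (h : IsUpperGradient E u g) :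
    IsWeakUpperGradient μ p E u g :=
  ⟨h.1.aemeasurable, (weakUpperGradient_modulus_iff hp).2 (.of_forall h.2)⟩

theorem isWeakUpperGradient_of_eventually (hp : 0 < p) (hg : AEMeasurable g (μ.restrict E))
    (h : ∀ᶠ γ in curveFilter μ p, γ.IsIn E → UpperGradientIneq u g γ) :
    IsWeakUpperGradient μ p E u g :=
  ⟨hg, (weakUpperGradient_modulus_iff hp).2 h⟩

variable [BorelSpace X]

/-- Almost every curve has no exceptional subcurve and a finite integral of `g`, which is what
`acBound_of_sub` needs. -/
theorem IsWeakUpperGradient.eventually_acBound (hp : 0 < p) (hE : MeasurableSet E)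
    (h : IsWeakUpperGradient μ p E u g) (hi : ∫⁻ x in E, g x ^ p ∂μ < ∞) :
    ∀ᶠ γ in curveFilter μ p, γ.IsIn E → ACBound γ u g := by
  filter_upwards [eventually_sub hp ((weakUpperGradient_modulus_iff hp).1 h.2),
    eventually_integrable hp hE h.1 hi] with γ h1 h2 hin
  exact acBound_of_sub (h2 hin).1 (h2 hin).2 fun s t hs hst ht =>
    h1 s t hs hst ht (hin.sub s t hs hst ht)

/-- The inequality between endpoints does not pass to infima of gradients, but the pointwise bound
on the derivative does. -/
theorem IsWeakUpperGradient.iInf (hp : 0 < p) (hE : MeasurableSet E) {G : ℕ → X → ℝ≥0∞}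
    (h : ∀ n, IsWeakUpperGradient μ p E u (G n)) (hi : ∀ n, ∫⁻ x in E, G n x ^ p ∂μ < ∞) :
    IsWeakUpperGradient μ p E u fun x => ⨅ n, G n x := by
  have := countableInterFilter_curveFilter (X := X) (μ := μ) hp
  refine isWeakUpperGradient_of_eventually hp (.iInf fun n => (h n).1) ?_
  filter_upwards [eventually_countable_forall.2 fun n => (h n).eventually_acBound hp hE (hi n)]
    with γ hγ hin
  have h0 := hγ 0 hin
  refine ACBound.upperGradientIneq ⟨h0.finite, h0.ac, ?_⟩
  filter_upwards [ae_all_iff.2 fun n => (hγ n hin).deriv_le] with t ht using le_iInf ht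

theorem IsWeakUpperGradient.min (hp : 0 < p) (hE : MeasurableSet E)
    (h : IsWeakUpperGradient μ p E u g) (hi : ∫⁻ x in E, g x ^ p ∂μ < ∞)
    (h' : IsWeakUpperGradient μ p E u g') (hi' : ∫⁻ x in E, g' x ^ p ∂μ < ∞) :
    IsWeakUpperGradient μ p E u fun x => Min.min (g x) (g' x) := by
  refine isWeakUpperGradient_of_eventually hp (h.1.min h'.1) ?_
  filter_upwards [h.eventually_acBound hp hE hi, h'.eventually_acBound hp hE hi'] with γ h1 h2 hin
  refine ACBound.upperGradientIneq ⟨(h1 hin).finite, (h1 hin).ac, ?_⟩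
  filter_upwards [(h1 hin).deriv_le, (h2 hin).deriv_le] with t h3 h4 using le_min h3 h4

/-- Existence of minimal weak upper gradients. -/
theorem exists_isMinimalWeakUpperGradient (hp : 0 < p) (hE : MeasurableSet E)
    (h : IsWeakUpperGradient μ p E u g) (hi : ∫⁻ x in E, g x ^ p ∂μ < ∞) :
    ∃ G, IsMinimalWeakUpperGradient μ p E u G := by
  set m : ℝ≥0∞ := ⨅ (f : X → ℝ≥0∞) (_ : IsWeakUpperGradient μ p E u f), ∫⁻ x in E, f x ^ p ∂μ
  have hm : m < ∞ := lt_of_le_of_lt (iInf₂_le g h) hi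
  have hex : ∀ n : ℕ, ∃ f, IsWeakUpperGradient μ p E u f ∧
      ∫⁻ x in E, f x ^ p ∂μ < m + ((n : ℝ≥0∞) + 1)⁻¹ := by
    intro n
    have : m < m + ((n : ℝ≥0∞) + 1)⁻¹ := ENNReal.lt_add_right hm.ne (by simp)
    simpa only [m, iInf_lt_iff, exists_prop] using this
  choose F hF hlt using hex
  have hFi : ∀ n, ∫⁻ x in E, F n x ^ p ∂μ < ∞ := fun n => (hlt n).trans_le le_top
  have hG := IsWeakUpperGradient.iInf hp hE hF hFi
  have hGm : ∫⁻ x in E, (⨅ n, F n x) ^ p ∂μ ≤ m := by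
    refine ge_of_tendsto' (x := atTop) (f := fun n : ℕ => m + ((n : ℝ≥0∞) + 1)⁻¹) ?_ fun n => ?_
    · have h1 : Tendsto (fun n : ℕ => ((n : ℝ≥0∞) + 1)⁻¹) atTop (𝓝 0) := by
        have := (tendsto_add_atTop_iff_nat 1).2 ENNReal.tendsto_inv_nat_nhds_zero
        simpa using this
      simpa using h1.const_add m
    · refine (lintegral_mono fun x => ?_).trans (hlt n).le
      exact ENNReal.rpow_le_rpow (iInf_le _ n) hp.le
  have hGi : ∫⁻ x in E, (⨅ n, F n x) ^ p ∂μ < ∞ := hGm.trans_lt hm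
  refine ⟨fun x => ⨅ n, F n x, hG, hGi, fun f hf hfi => ?_⟩
  -- The minimum with any other `f` has energy at least `m`, hence at least that of the infimum. As
  -- it lies below the infimum, the two agree a.e.
  have hmin := hG.min hp hE hGi hf hfi
  have hle : ∀ x, Min.min (⨅ n, F n x) (f x) ^ p ≤ (⨅ n, F n x) ^ p :=
    fun x => ENNReal.rpow_le_rpow (min_le_left _ _) hp.le
  have heq := ae_eq_of_ae_le_of_lintegral_le (.of_forall hle)
    ((lintegral_mono hle).trans_lt hGi).ne (hG.1.pow_const p) (hGm.trans (iInf₂_le _ hmin))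
  filter_upwards [heq] with x hx
  have := ENNReal.rpow_left_injective hp.ne' hx
  exact min_eq_left_iff.1 this

/-- A genuine upper gradient is the maximum of a Borel representative of `g` and a density whose
integral is infinite along every exceptional curve. -/
theorem IsWeakUpperGradient.memDirichlet (hp : 0 < p) (hE : MeasurableSet E)
    (hu : AEMeasurable u (μ.restrict E)) (h : IsWeakUpperGradient μ p E u g)
    (hi : ∫⁻ x in E, g x ^ p ∂μ < ∞) : MemDirichlet μ p E u := by
  refine ⟨hu, ?_⟩
  have hev := ((weakUpperGradient_modulus_iff hp).1 h.2).and
    (eventually_ae_of_ae_restrict hp hE h.1.ae_eq_mk)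
  obtain ⟨ρ, hm, hρi, hρ⟩ := (eventually_curveFilter_iff hp).1 hev
  refine ⟨fun x => max (h.1.mk g x) (ρ x), ⟨h.1.measurable_mk.max hm, fun γ hin => ?_⟩, ?_⟩
  · by_cases hγ : γ.integral ρ < ∞
    · obtain ⟨h1, h2⟩ := hρ γ hγ
      refine (h1 hin).trans ((lintegral_congr_ae (h2 hin)).trans_le ?_)
      exact γ.integral_mono fun x => le_max_left _ _
    · have : γ.integral ρ = ∞ := by simpa using hγ
      unfold UpperGradientIneq
      refine le_top.trans (this.symm.trans_le (γ.integral_mono fun x => le_max_right _ _))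
  · calc ∫⁻ x in E, max (h.1.mk g x) (ρ x) ^ p ∂μ
        ≤ ∫⁻ x in E, (h.1.mk g x ^ p + ρ x ^ p) ∂μ := lintegral_mono fun x => max_rpow_le_add p _ _
      _ = ∫⁻ x in E, h.1.mk g x ^ p ∂μ + ∫⁻ x in E, ρ x ^ p ∂μ :=
          lintegral_add_right _ (hm.pow_const p)
      _ < ∞ := by
          refine ENNReal.add_lt_top.2 ⟨?_, lt_of_le_of_lt (setLIntegral_le_lintegral _ _) hρi⟩
          refine lt_of_le_of_lt (lintegral_mono_ae ?_) hi
          filter_upwards [h.1.ae_eq_mk] with x hx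
          rw [hx]

theorem MemDirichlet.minimalGradient_spec (hp : 0 < p) (hE : MeasurableSet E)
    (h : MemDirichlet μ p E u) :
    IsMinimalWeakUpperGradient μ p E u (minimalGradient μ p E u) := by
  obtain ⟨g, hg, hi⟩ := h.2
  have hex := exists_isMinimalWeakUpperGradient hp hE (hg.isWeakUpperGradient hp) hi
  unfold minimalGradient
  rw [dif_pos hex]
  exact hex.choose_spec

theorem energy_le (hp : 0 < p) (hE : MeasurableSet E) (hu : AEMeasurable u (μ.restrict E))
    (h : IsWeakUpperGradient μ p E u g) : energy μ p E u ≤ ∫⁻ x in E, g x ^ p ∂μ := by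
  by_cases hi : ∫⁻ x in E, g x ^ p ∂μ < ∞
  · have hs := (h.memDirichlet hp hE hu hi).minimalGradient_spec hp hE
    refine lintegral_mono_ae ?_
    filter_upwards [hs.2.2 g h hi] with x hx using ENNReal.rpow_le_rpow hx hp.le
  · simp only [not_lt, top_le_iff] at hi
    rw [hi]
    exact le_top

end Gradients

/-! ### Sets of zero capacity -/

section Capacity

variable {X : Type*} [MetricSpace X]

theorem UpperGradientIneq.max {γ : Curve X} {u v : X → EReal} {g g' : X → ℝ≥0∞}
    (hu : UpperGradientIneq u g γ) (hv : UpperGradientIneq v g' γ) :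
    UpperGradientIneq (fun x => Max.max (u x) (v x)) (fun x => Max.max (g x) (g' x)) γ := by
  have hu' := hu.trans (γ.integral_mono fun x => le_max_left (g x) (g' x))
  have hv' := hv.trans (γ.integral_mono fun x => le_max_right (g x) (g' x))
  unfold UpperGradientIneq
  by_cases htop : γ.integral (fun x => Max.max (g x) (g' x)) = ∞
  · rw [htop]; exact le_top
  obtain ⟨h1, h2⟩ := ne_of_gap_ne_top (ne_top_of_le_ne_top htop hu')
  obtain ⟨h3, h4⟩ := ne_of_gap_ne_top (ne_top_of_le_ne_top htop hv')
  rw [gap_of_ne h1 h2] at hu'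
  rw [gap_of_ne h3 h4] at hv'
  obtain ⟨a, ha⟩ : ∃ a : ℝ, u (γ.toFun 0) = a := ⟨_, (EReal.coe_toReal h1.1 h1.2).symm⟩
  obtain ⟨b, hb⟩ : ∃ b : ℝ, u (γ.toFun γ.length) = b := ⟨_, (EReal.coe_toReal h2.1 h2.2).symm⟩
  obtain ⟨c, hc⟩ : ∃ c : ℝ, v (γ.toFun 0) = c := ⟨_, (EReal.coe_toReal h3.1 h3.2).symm⟩
  obtain ⟨d, hd⟩ : ∃ d : ℝ, v (γ.toFun γ.length) = d := ⟨_, (EReal.coe_toReal h4.1 h4.2).symm⟩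
  simp only [ha, hb, hc, hd, EReal.toReal_coe] at hu' hv' ⊢
  rw [← EReal.coe_strictMono.monotone.map_max, ← EReal.coe_strictMono.monotone.map_max,
    gap_of_ne (by simp) (by simp), EReal.toReal_coe, EReal.toReal_coe]
  refine (ENNReal.ofReal_le_ofReal (abs_max_sub_max_le_max a c b d)).trans ?_
  rw [ENNReal.ofReal_max]
  exact max_le hu' hv'

theorem one_ne_top_bot : (1 : EReal) ≠ ⊤ ∧ (1 : EReal) ≠ ⊥ :=
  ⟨EReal.coe_ne_top 1, EReal.coe_ne_bot 1⟩

theorem measurable_ereal_abs : Measurable EReal.abs :=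
  EReal.measurable_of_measurable_real (by
    simp only [EReal.abs_def]
    exact (measurable_id.abs).ennreal_ofReal)

variable [MeasurableSpace X] {μ : Measure X} {p : ℝ} {A B : Set X}

theorem capacity_mono (h : A ⊆ B) : capacity μ p A ≤ capacity μ p B :=
  le_iInf₂ fun u hu => le_iInf fun hB => iInf₂_le_of_le u hu (iInf_le _ fun x hx => hB x (h hx))

theorem capacity_eq_zero_of_subset (h : A ⊆ B) (hB : capacity μ p B = 0) : capacity μ p A = 0 :=
  le_antisymm ((capacity_mono h).trans hB.le) bot_le

variable [BorelSpace X]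

/-- The maximum of two competitors competes for the union, and the `p`-th power of a maximum is at
most the sum of the powers. -/
theorem capacity_union_le (hp : 0 < p) :
    capacity μ p (A ∪ B) ≤ capacity μ p A + capacity μ p B := by
  have key : ∀ u v, MemNewton μ p u → (∀ x ∈ A, 1 ≤ u x) → MemNewton μ p v → (∀ x ∈ B, 1 ≤ v x) →
      capacity μ p (A ∪ B) ≤ newtonNormPow μ p u + newtonNormPow μ p v := by
    intro u v hu huA hv hvB
    have su := hu.1.minimalGradient_spec hp .univ
    have sv := hv.1.minimalGradient_spec hp .univ
    have hmeas : AEMeasurable (fun x => max (u x) (v x)) (μ.restrict univ) := hu.1.1.max hv.1.1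
    set G : X → ℝ≥0∞ := fun x =>
      max (minimalGradient μ p univ u x) (minimalGradient μ p univ v x)
    have hG : IsWeakUpperGradient μ p univ (fun x => max (u x) (v x)) G := by
      refine isWeakUpperGradient_of_eventually hp (su.1.1.max sv.1.1) ?_
      filter_upwards [(weakUpperGradient_modulus_iff hp).1 su.1.2,
        (weakUpperGradient_modulus_iff hp).1 sv.1.2] with γ h1 h2 hin
      exact (h1 hin).max (h2 hin)
    have hGle : ∫⁻ x in univ, G x ^ p ∂μ ≤ energy μ p univ u + energy μ p univ v := by
      unfold energy
      rw [← lintegral_add_left' (su.1.1.pow_const p)]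
      exact lintegral_mono fun x => max_rpow_le_add p _ _
    have hE := (energy_le hp .univ hmeas hG).trans hGle
    have hN : newtonNormPow μ p (fun x => max (u x) (v x)) ≤
        newtonNormPow μ p u + newtonNormPow μ p v := by
      have habs : ∫⁻ x, (max (u x) (v x)).abs ^ p ∂μ ≤
          ∫⁻ x, (u x).abs ^ p ∂μ + ∫⁻ x, (v x).abs ^ p ∂μ := by
        have hum : AEMeasurable u μ := by simpa using hu.1.1
        have hm : AEMeasurable (fun x => (u x).abs ^ p) μ :=
          (measurable_ereal_abs.comp_aemeasurable hum).pow_const p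
        rw [← lintegral_add_left' hm]
        refine lintegral_mono fun x => ?_
        rcases le_total (u x) (v x) with h | h
        · simp only [max_eq_right h]; exact le_add_self
        · simp only [max_eq_left h]; exact le_self_add
      unfold newtonNormPow
      refine (add_le_add habs hE).trans (le_of_eq ?_)
      ring
    have hlt : newtonNormPow μ p (fun x => max (u x) (v x)) < ∞ :=
      hN.trans_lt (ENNReal.add_lt_top.2 ⟨hu.2, hv.2⟩)
    refine (iInf₂_le_of_le (fun x => max (u x) (v x)) ⟨?memD, hlt⟩
      (iInf_le _ ?ge)).trans hN
    case memD =>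
      exact hG.memDirichlet hp .univ hmeas
        (hGle.trans_lt (ENNReal.add_lt_top.2
          ⟨lt_of_le_of_lt le_add_self hu.2, lt_of_le_of_lt le_add_self hv.2⟩))
    case ge =>
      rintro x (hx | hx)
      · exact (huA x hx).trans (le_max_left _ _)
      · exact (hvB x hx).trans (le_max_right _ _)
  rw [capacity, capacity, capacity]
  simp only [ENNReal.iInf_add, ENNReal.add_iInf]
  refine le_iInf fun v => le_iInf fun hv => le_iInf fun hvB => le_iInf fun u => le_iInf fun hu =>
    le_iInf fun huA => ?_
  exact key _ _ hu huA hv hvB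

theorem capacity_union_eq_zero (hp : 0 < p) (hA : capacity μ p A = 0) (hB : capacity μ p B = 0) :
    capacity μ p (A ∪ B) = 0 :=
  le_antisymm ((capacity_union_le hp).trans (by rw [hA, hB, add_zero])) bot_le

/-- A null set whose indicator function is constant along `p`-almost every curve has zero
capacity. -/
theorem capacity_eq_zero_of_null (hp : 0 < p) (hA : μ A = 0)
    (h : ∀ᶠ γ in curveFilter μ p, (γ.toFun 0 ∈ A ↔ γ.toFun γ.length ∈ A)) :
    capacity μ p A = 0 := by
  classical
  set u : X → EReal := fun x => if x ∈ A then 1 else 0 with hu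
  have hae : u =ᵐ[μ] fun _ => 0 := by
    filter_upwards [measure_eq_zero_iff_ae_notMem.1 hA] with x hx
    simp [hu, hx]
  have hmeas : AEMeasurable u (μ.restrict univ) := by
    rw [Measure.restrict_univ]
    exact aemeasurable_const.congr hae.symm
  have hG : IsWeakUpperGradient μ p univ u fun _ => 0 := by
    refine isWeakUpperGradient_of_eventually hp aemeasurable_const ?_
    filter_upwards [h] with γ hγ _
    have heq : u (γ.toFun 0) = u (γ.toFun γ.length) := by simp only [hu, hγ]
    have hfin : u (γ.toFun γ.length) ≠ ⊤ ∧ u (γ.toFun γ.length) ≠ ⊥ := by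
      simp only [hu]
      split_ifs <;> simp [one_ne_top_bot]
    unfold UpperGradientIneq
    rw [heq, gap_of_ne hfin hfin]
    simp
  have hE : energy μ p univ u = 0 := by
    refine le_antisymm ((energy_le hp .univ hmeas hG).trans ?_) bot_le
    simp [hp]
  have hN : newtonNormPow μ p u = 0 := by
    unfold newtonNormPow
    rw [hE, add_zero]
    rw [lintegral_congr_ae (g := fun _ => 0)]
    · simp
    · filter_upwards [hae] with x hx
      simp [hx, hp]
  refine le_antisymm ((iInf₂_le_of_le u ⟨?memD, by simp [hN]⟩ (iInf_le _ ?ge)).trans hN.le) bot_le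
  case memD =>
    exact hG.memDirichlet hp .univ hmeas (by simp [hp])
  case ge =>
    intro x hx
    simp [hu, hx]

/-! ### Consequences of the Poincaré inequality -/

/-- The Poincaré inequality asks for an integrable function and a genuine upper gradient. Cutting
`A` off at a ball gives integrability, and the value `∞` off the open ball pays for the jump at its
boundary. Inside, `ε * ρ` takes care of the exceptional curves at arbitrarily small cost. -/
theorem isUpperGradient_indicator_ball {x : X} {R : ℝ} {ρ : X → ℝ≥0∞} (hρm : Measurable ρ)
    (hρ : ∀ γ : Curve X, γ.integral ρ < ∞ → (γ.toFun 0 ∈ A ↔ γ.toFun γ.length ∈ A))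
    {ε : ℝ≥0∞} (hε : ε ≠ 0) (hε' : ε ≠ ∞) :
    IsUpperGradient univ ((A ∩ closedBall x R).indicator fun _ => (1 : EReal))
      ((ball x R)ᶜ.indicator (fun _ => ∞) + (ball x R).indicator fun y => ε * ρ y) := by
  refine ⟨(measurable_const.indicator measurableSet_ball.compl).add
    ((hρm.const_mul _).indicator measurableSet_ball), fun γ _ => ?_⟩
  set g : X → ℝ≥0∞ :=
    (ball x R)ᶜ.indicator (fun _ => ∞) + (ball x R).indicator fun y => ε * ρ y with hgdef
  have hgm : Measurable g := (measurable_const.indicator measurableSet_ball.compl).add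
    ((hρm.const_mul _).indicator measurableSet_ball)
  unfold UpperGradientIneq
  by_cases htop : γ.integral g = ∞
  · rw [htop]; exact le_top
  have hae : ∀ᵐ t ∂volume.restrict (Icc 0 γ.length), γ.toFun t ∈ ball x R := by
    filter_upwards [ae_lt_top' (hgm.comp_aemeasurable γ.aemeasurable) htop] with t ht
    by_contra hn
    simp [hgdef, hn] at ht
  -- The curve is in the open ball for almost every time, hence by continuity in the closed ball for
  -- every time.
  have hcl : ∀ t ∈ Icc 0 γ.length, γ.toFun t ∈ closedBall x R := by
    have hcont : ContinuousOn (fun t => max (dist (γ.toFun t) x) R) (Icc 0 γ.length) :=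
      ((continuous_id.dist continuous_const).max continuous_const :
        Continuous fun y => max (dist y x) R).comp_continuousOn γ.continuousOn
    have := Measure.eqOn_Icc_of_ae_eq volume γ.length_pos.ne
      (f := fun t => max (dist (γ.toFun t) x) R) (g := fun _ => R)
      (by filter_upwards [hae] with t ht using max_eq_right (mem_ball.1 ht).le)
      hcont continuousOn_const
    intro t ht
    exact max_eq_right_iff.1 (this ht)
  have hint : γ.integral ρ < ∞ := by
    have h1 : ε * γ.integral ρ ≤ γ.integral g := by
      unfold Curve.integral
      rw [← lintegral_const_mul' _ _ hε']
      refine lintegral_mono fun t => ?_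
      by_cases ht : γ.toFun t ∈ ball x R <;> simp [hgdef, ht]
    refine lt_top_iff_ne_top.2 fun h => htop ?_
    rw [h, ENNReal.mul_top hε] at h1
    exact top_le_iff.1 h1
  have hiff := hρ γ hint
  have h0 := hcl 0 ⟨le_rfl, γ.length_pos.le⟩
  have hl := hcl _ ⟨γ.length_pos.le, le_rfl⟩
  by_cases hA : γ.toFun 0 ∈ A
  · rw [indicator_of_mem (mem_inter hA h0), indicator_of_mem (mem_inter (hiff.1 hA) hl),
      gap_of_ne one_ne_top_bot one_ne_top_bot]
    simp
  · rw [indicator_of_notMem fun h => hA h.1, indicator_of_notMem fun h => hA (hiff.2 h.1),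
      gap_of_ne (by simp) (by simp)]
    simp

/-- Up to the cut-off, the indicator of `A` has upper gradients of arbitrarily small norm on the
enlarged ball, so its oscillation on the ball is zero and it is a.e. constant there. -/
theorem null_or_conull_ball (hp : 0 < p)
    (hμ : ∀ (x : X) (r : ℝ), 0 < r → 0 < μ (ball x r) ∧ μ (ball x r) < ∞)
    (hPI : SupportsPoincare μ p p) (hA : NullMeasurableSet A μ)
    (h : ∀ᶠ γ in curveFilter μ p, (γ.toFun 0 ∈ A ↔ γ.toFun γ.length ∈ A))
    (x : X) {r : ℝ} (hr : 0 < r) : μ (ball x r ∩ A) = 0 ∨ μ (ball x r \ A) = 0 := by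
  obtain ⟨C, hC, lam, hlam, hPI⟩ := hPI
  obtain ⟨ρ, hρm, hρi, hρ⟩ := (eventually_curveFilter_iff hp).1 h
  set R := lam * r with hR
  have hrR : r ≤ R := by rw [hR]; nlinarith
  have hRpos : 0 < R := hr.trans_le hrR
  set D : Set X := A ∩ closedBall x R with hD
  have hDm : NullMeasurableSet D μ := hA.inter measurableSet_closedBall.nullMeasurableSet
  have hDfin : μ D ≠ ∞ := by
    refine ne_top_of_le_ne_top (hμ x (R + 1) (by linarith)).2.ne (measure_mono ?_)
    exact inter_subset_right.trans (closedBall_subset_ball (by linarith))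
  set u : X → EReal := D.indicator fun _ => (1 : EReal) with hu
  set χ : X → ℝ := D.indicator fun _ => (1 : ℝ) with hχ
  have huχ : (fun y => (u y).toReal) = χ := by
    ext y
    by_cases hy : y ∈ D <;> simp [hu, hχ, hy]
  have hχint : Integrable χ μ := by
    exact (integrableOn_const hDfin).integrable_indicator₀ hDm
  have hfin : ∀ y, u y ≠ ⊤ ∧ u y ≠ ⊥ := by
    intro y
    by_cases hy : y ∈ D <;> simp [hu, hy, one_ne_top_bot]
  set avg := ⨍ z in ball x r, χ z ∂μ with havg
  set K : ℝ≥0∞ := ENNReal.ofReal (C * diam (ball x r)) *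
    ((∫⁻ y, ρ y ^ p ∂μ) / μ (ball x R)) ^ (1 / p) with hK
  have hKtop : K ≠ ∞ := by
    refine ENNReal.mul_ne_top ENNReal.ofReal_ne_top
      (ENNReal.rpow_ne_top_of_nonneg (by positivity) ?_)
    exact ENNReal.div_ne_top hρi.ne (hμ x R hRpos).1.ne'
  have hbound : ∀ n : ℕ, ((∫⁻ y in ball x r, ‖χ y - avg‖ₑ ^ p ∂μ) / μ (ball x r)) ^ (1 / p) ≤
      K * ((n : ℝ≥0∞) + 1)⁻¹ := by
    intro n
    set ε : ℝ≥0∞ := ((n : ℝ≥0∞) + 1)⁻¹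
    have hε : ε ≠ 0 :=
      ENNReal.inv_ne_zero.2 (ENNReal.add_ne_top.2 ⟨ENNReal.natCast_ne_top n, ENNReal.one_ne_top⟩)
    have hε' : ε ≠ ∞ := ENNReal.inv_ne_top.2 (by simp)
    have := hPI x r hr u (.of_forall hfin) (by rw [huχ]; exact hχint) _
      (isUpperGradient_indicator_ball hρm hρ hε hε')
    have hcoe : ∀ y, (u y).toReal = χ y := fun y => congrFun huχ y
    simp only [hcoe] at this
    refine this.trans ?_
    rw [hK, mul_assoc]
    gcongr
    -- The integral is over the open ball of radius `R`, so the infinite part of the gradient does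
    -- not contribute.
    have hint : ∫⁻ y in ball x R, (((ball x R)ᶜ.indicator (fun _ => (∞ : ℝ≥0∞)) +
        (ball x R).indicator fun y => ε * ρ y) y) ^ p ∂μ ≤ ε ^ p * ∫⁻ y, ρ y ^ p ∂μ := by
      rw [← lintegral_const_mul _ (hρm.pow_const p)]
      refine (setLIntegral_mono' measurableSet_ball fun y hy => ?_).trans
        (setLIntegral_le_lintegral _ _)
      rw [Pi.add_apply, indicator_of_notMem (by simpa using hy), indicator_of_mem hy, zero_add,
        ENNReal.mul_rpow_of_nonneg _ _ hp.le]
    calc (_ / μ (ball x R)) ^ (1 / p)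
        ≤ (ε ^ p * (∫⁻ y, ρ y ^ p ∂μ) / μ (ball x R)) ^ (1 / p) := by
          gcongr
      _ = ((∫⁻ y, ρ y ^ p ∂μ) / μ (ball x R)) ^ (1 / p) * ε := by
          rw [mul_div_assoc, ENNReal.mul_rpow_of_nonneg _ _ (by positivity), ← ENNReal.rpow_mul,
            mul_one_div_cancel hp.ne', ENNReal.rpow_one, mul_comm]
  have hzero : ((∫⁻ y in ball x r, ‖χ y - avg‖ₑ ^ p ∂μ) / μ (ball x r)) ^ (1 / p) = 0 := by
    refine le_antisymm (ge_of_tendsto' (x := atTop) ?_ hbound) bot_le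
    have h1 : Tendsto (fun n : ℕ => ((n : ℝ≥0∞) + 1)⁻¹) atTop (𝓝 0) := by
      have := (tendsto_add_atTop_iff_nat 1).2 ENNReal.tendsto_inv_nat_nhds_zero
      simpa using this
    simpa using ENNReal.Tendsto.const_mul h1 (Or.inr hKtop)
  have hint0 : ∫⁻ y in ball x r, ‖χ y - avg‖ₑ ^ p ∂μ = 0 := by
    rw [ENNReal.rpow_eq_zero_iff_of_pos (by positivity), ENNReal.div_eq_zero_iff] at hzero
    exact hzero.resolve_right (hμ x r hr).2.ne
  have hχm : AEMeasurable (fun y => ‖χ y - avg‖ₑ ^ p) (μ.restrict (ball x r)) :=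
    ((hχint.1.aemeasurable.sub_const avg).enorm.pow_const p).mono_measure Measure.restrict_le_self
  rw [lintegral_eq_zero_iff' hχm] at hint0
  have hconst : ∀ᵐ y ∂μ.restrict (ball x r), χ y = avg := by
    filter_upwards [hint0] with y hy
    simpa [hp, hp.le, hp.not_gt, sub_eq_zero] using hy
  rw [ae_restrict_iff' measurableSet_ball] at hconst
  by_cases h1 : avg = 1
  · right
    rw [measure_eq_zero_iff_ae_notMem]
    filter_upwards [hconst] with y hy hmem
    have := hy hmem.1
    have hyD : y ∉ D := fun h => hmem.2 h.1
    simp [hχ, hyD, h1] at this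
  · left
    rw [measure_eq_zero_iff_ae_notMem]
    filter_upwards [hconst] with y hy hmem
    have := hy hmem.1
    have hyD : y ∈ D := ⟨hmem.2, closedBall_subset_closedBall hrR (ball_subset_closedBall hmem.1)⟩
    simp only [hχ, indicator_of_mem hyD] at this
    exact h1 this.symm

/-- A set whose indicator function is constant along `p`-almost every curve is null or conull. -/
theorem null_or_conull (hp : 0 < p) [Nonempty X]
    (hμ : ∀ (x : X) (r : ℝ), 0 < r → 0 < μ (ball x r) ∧ μ (ball x r) < ∞)
    (hPI : SupportsPoincare μ p p) (hA : NullMeasurableSet A μ)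
    (h : ∀ᶠ γ in curveFilter μ p, (γ.toFun 0 ∈ A ↔ γ.toFun γ.length ∈ A)) :
    μ A = 0 ∨ μ Aᶜ = 0 := by
  obtain ⟨x⟩ := ‹Nonempty X›
  have key : ∀ n : ℕ, μ (ball x (n + 1) ∩ A) = 0 ∨ μ (ball x (n + 1) \ A) = 0 := fun n =>
    null_or_conull_ball hp hμ hPI hA h x (by positivity)
  have hcover : ∀ y, ∀ᶠ n : ℕ in atTop, y ∈ ball x (n + 1) := by
    intro y
    filter_upwards [eventually_ge_atTop ⌈dist y x⌉₊] with n hn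
    exact mem_ball.2 (by linarith [Nat.ceil_le.1 hn])
  by_cases hall : ∀ n : ℕ, μ (ball x (n + 1) ∩ A) = 0
  · left
    refine measure_mono_null (fun y hy => ?_) (measure_iUnion_null hall)
    obtain ⟨n, hn⟩ := (hcover y).exists
    exact mem_iUnion.2 ⟨n, hn, hy⟩
  · right
    push Not at hall
    obtain ⟨m, hm⟩ := hall
    -- Once one ball meets `A` in positive measure, so does every larger concentric ball, and the
    -- second alternative must hold in each of them.
    have hall' : ∀ n : ℕ, μ (ball x ((n + m : ℕ) + 1) \ A) = 0 := fun n =>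
      (key (n + m)).resolve_left fun h0 => hm (measure_mono_null (inter_subset_inter_left _
        (ball_subset_ball (by push_cast; linarith [(Nat.cast_nonneg n : (0 : ℝ) ≤ n)]))) h0)
    refine measure_mono_null (fun y hy => ?_) (measure_iUnion_null hall')
    obtain ⟨n, hn⟩ := ((tendsto_add_atTop_nat m).eventually (hcover y)).exists
    exact mem_iUnion.2 ⟨n, hn, hy⟩

/-- A set whose indicator function is constant along `p`-almost every curve has zero capacity, or
its complement has. -/
theorem capacity_eq_zero_or_compl (hp : 0 < p) [Nonempty X]
    (hμ : ∀ (x : X) (r : ℝ), 0 < r → 0 < μ (ball x r) ∧ μ (ball x r) < ∞)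
    (hPI : SupportsPoincare μ p p) (hA : NullMeasurableSet A μ)
    (h : ∀ᶠ γ in curveFilter μ p, (γ.toFun 0 ∈ A ↔ γ.toFun γ.length ∈ A)) :
    capacity μ p A = 0 ∨ capacity μ p Aᶜ = 0 := by
  refine (null_or_conull hp hμ hPI hA h).imp (fun h0 => capacity_eq_zero_of_null hp h0 h)
    fun h0 => capacity_eq_zero_of_null hp h0 ?_
  filter_upwards [h] with γ hγ using not_congr hγ

end Capacity

/-! ### Composition and gluing of functions with weak upper gradients -/

/-- The set where both functions are finite. -/
def finiteSet {X : Type*} (u v : X → EReal) : Set X := {x | (u x ≠ ⊤ ∧ u x ≠ ⊥) ∧ (v x ≠ ⊤ ∧ v x ≠ ⊥)}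

section Calculus

variable {X : Type*} [MetricSpace X]

/-- The real function `k` is differentiable almost everywhere along `γ`, with derivative bounded
by `g`. -/
def DerivBound (γ : Curve X) (k : X → ℝ) (g : X → ℝ≥0∞) : Prop :=
  ∀ᵐ t ∂volume.restrict (Icc 0 γ.length),
    DifferentiableAt ℝ (fun t => k (γ.toFun t)) t ∧
      ‖deriv (fun t => k (γ.toFun t)) t‖ₑ ≤ g (γ.toFun t)

theorem ACBound.derivBound {γ : Curve X} {u : X → EReal} {g : X → ℝ≥0∞} (h : ACBound γ u g) :
    DerivBound γ (fun x => (u x).toReal) g := by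
  filter_upwards [h.ae_differentiableAt, h.deriv_le] with t h1 h2 using ⟨h1, h2⟩

theorem derivBound_const (γ : Curve X) (c : ℝ) : DerivBound γ (fun _ => c) fun _ => 0 :=
  .of_forall fun t => ⟨differentiableAt_const c, by simp⟩

theorem DerivBound.sub {γ : Curve X} {k k' : X → ℝ} {g g' : X → ℝ≥0∞} (h : DerivBound γ k g)
    (h' : DerivBound γ k' g') : DerivBound γ (fun x => k x - k' x) fun x => g x + g' x := by
  filter_upwards [h, h'] with t h1 h2
  refine ⟨h1.1.sub h2.1, ?_⟩
  rw [deriv_fun_sub h1.1 h2.1]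
  exact enorm_sub_le.trans (add_le_add h1.2 h2.2)

theorem DerivBound.midpoint {γ : Curve X} {k k' : X → ℝ} {g g' : X → ℝ≥0∞} (h : DerivBound γ k g)
    (h' : DerivBound γ k' g') :
    DerivBound γ (fun x => (k x + k' x) / 2) fun x => (g x + g' x) / 2 := by
  filter_upwards [h, h'] with t h1 h2
  refine ⟨(h1.1.add h2.1).div_const 2, ?_⟩
  rw [deriv_div_const, deriv_fun_add h1.1 h2.1, div_eq_mul_inv, enorm_mul, div_eq_mul_inv]
  refine mul_le_mul' ((enorm_add_le _ _).trans (add_le_add h1.2 h2.2)) (le_of_eq ?_)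
  rw [enorm_inv two_ne_zero]
  simp [Real.enorm_eq_ofReal]

/-- If a function agrees at each point of a curve with one of countably many functions, then its
derivative is controlled by the respective bounds. -/
theorem ACBound.of_pieces {ι : Type*} [Countable ι] {γ : Curve X} {v : X → EReal}
    {g G : X → ℝ≥0∞} (h : ACBound γ v g) {k : ι → X → ℝ} {gk : ι → X → ℝ≥0∞}
    (hk : ∀ i, DerivBound γ (k i) (gk i))
    (hcov : ∀ t ∈ Icc 0 γ.length,
      ∃ i, (v (γ.toFun t)).toReal = k i (γ.toFun t) ∧ gk i (γ.toFun t) ≤ G (γ.toFun t)) :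
    ACBound γ v G := by
  refine ⟨h.finite, h.ac, ?_⟩
  -- For almost every time and all pieces at once, agreement of the values implies agreement of the
  -- derivatives. Countability of `ι` enters here.
  have heq := ae_all_iff.2 fun i => ae_restrict_of_ae (s := Icc 0 γ.length)
    (ae_deriv_eq_of_eq (fun t => (v (γ.toFun t)).toReal) fun t => k i (γ.toFun t))
  filter_upwards [heq, ae_all_iff.2 hk, h.ae_differentiableAt, ae_restrict_mem measurableSet_Icc]
    with t h1 h2 h3 ht
  obtain ⟨i, hi, hG⟩ := hcov t ht
  rw [h1 i hi h3 (h2 i).1]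
  exact (h2 i).2.trans hG

/-- Curves remain in an open set near each of their points in the set. -/
theorem Curve.exists_forall_mem (γ : Curve X) {Ω : Set X} (hΩ : IsOpen Ω) {t : ℝ} (ht : t ∈ Icc 0 γ.length)
    (hmem : γ.toFun t ∈ Ω) : ∃ δ > 0, ∀ s ∈ Icc 0 γ.length, |s - t| < δ → γ.toFun s ∈ Ω := by
  obtain ⟨δ, hδ, hball⟩ := Metric.isOpen_iff.1 hΩ _ hmem
  exact ⟨δ, hδ, fun s hs hst => hball (mem_ball.2 ((γ.dist_le hs ht).trans_lt hst))⟩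

variable [MeasurableSpace X] {μ : Measure X} {p : ℝ} {E Ω : Set X} {u u' v : X → EReal}
  {g g' G : X → ℝ≥0∞}

/-- `g` is a weak upper gradient of `u` in `L^p(E)`. -/
structure IsLpWeakUpperGradient (μ : Measure X) (p : ℝ) (E : Set X) (u : X → EReal)
    (g : X → ℝ≥0∞) : Prop where
  weak : IsWeakUpperGradient μ p E u g
  lt_top : ∫⁻ x in E, g x ^ p ∂μ < ∞

/-- A function on a measurable set that is dominated, along curves, by a function vanishing outside the
set has a weak upper gradient on the whole space when extended by zero. -/
theorem IsLpWeakUpperGradient.extend_zero (hp : 1 < p) (hΩ : MeasurableSet Ω)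
    {d w : X → EReal} (hd : IsLpWeakUpperGradient μ p Ω d g)
    (hw : ∀ x ∈ Ω, w x = d x) (hw0 : ∀ x ∉ Ω, w x = 0) {S : X → ℝ} (hS0 : ∀ x ∉ Ω, S x = 0)
    (hGm : AEMeasurable G μ) (hGi : ∫⁻ x, G x ^ p ∂μ < ∞)
    (hS : ∀ᶠ γ in curveFilter μ p, ∀ s t, 0 ≤ s → s ≤ t → t ≤ γ.length →
      ENNReal.ofReal |S (γ.toFun s) - S (γ.toFun t)| ≤ ∫⁻ τ in Icc s t, G (γ.toFun τ))
    (hle : ∀ᶠ γ in curveFilter μ p, ∀ t ∈ Icc 0 γ.length, γ.toFun t ∈ Ω →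
      (d (γ.toFun t) ≠ ⊤ ∧ d (γ.toFun t) ≠ ⊥) ∧ |(d (γ.toFun t)).toReal| ≤ S (γ.toFun t)) :
    ∃ H, IsLpWeakUpperGradient μ p univ w H := by
  have hp0 := zero_lt_one.trans hp
  have hgm : AEMeasurable (Ω.indicator g) μ := (aemeasurable_indicator_iff hΩ).2 hd.weak.1
  have hgi : ∫⁻ x, Ω.indicator g x ^ p ∂μ < ∞ := by
    have : ∀ x, Ω.indicator g x ^ p = Ω.indicator (fun x => g x ^ p) x := by
      intro x
      by_cases hx : x ∈ Ω <;> simp [hx, hp0]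
    simp_rw [this]
    rw [lintegral_indicator hΩ]
    exact hd.lt_top
  refine ⟨fun x => Ω.indicator g x + G x, ?_, ?_⟩
  swap
  · rw [Measure.restrict_univ]
    exact ENNReal.lintegral_rpow_add_lt_top_of_lintegral_rpow_lt_top hgm hgi hGi hp.le
  refine isWeakUpperGradient_of_eventually hp0
    (by rw [Measure.restrict_univ]; exact hgm.add hGm) ?_
  filter_upwards [(weakUpperGradient_modulus_iff hp0).1 hd.weak.2, hS, hle] with γ h1 h2 h3 _
  have m0 : (0 : ℝ) ∈ Icc 0 γ.length := ⟨le_rfl, γ.length_pos.le⟩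
  have ml : γ.length ∈ Icc 0 γ.length := ⟨γ.length_pos.le, le_rfl⟩
  by_cases hin : γ.IsIn Ω
  · have := h1 hin
    unfold UpperGradientIneq at this ⊢
    rw [hw _ (hin _ m0), hw _ (hin _ ml)]
    refine this.trans ?_
    unfold Curve.integral
    refine setLIntegral_mono' measurableSet_Icc fun t ht => ?_
    simp only [indicator_of_mem (hin t ht)]
    exact le_self_add
  -- The curve leaves `Ω` at some time `z`, where `S` vanishes. Each end value of `|w|` is at most
  -- that of `S`, which is paid for by the integral of `G` between that end and `z`.
  · have hbd : ∀ t ∈ Icc 0 γ.length, (w (γ.toFun t) ≠ ⊤ ∧ w (γ.toFun t) ≠ ⊥) ∧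
        |(w (γ.toFun t)).toReal| ≤ S (γ.toFun t) := by
      intro t ht
      by_cases hm : γ.toFun t ∈ Ω
      · rw [hw _ hm]; exact h3 t ht hm
      · rw [hw0 _ hm, hS0 _ hm]; simp
    obtain ⟨z, hz, hzΩ⟩ : ∃ z ∈ Icc 0 γ.length, γ.toFun z ∉ Ω := by
      unfold Curve.IsIn at hin
      push Not at hin
      exact hin
    unfold UpperGradientIneq
    rw [gap_of_ne (hbd 0 m0).1 (hbd _ ml).1]
    have e1 := h2 0 z le_rfl hz.1 hz.2
    have e2 := h2 z γ.length hz.1 hz.2 le_rfl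
    rw [hS0 _ hzΩ] at e1 e2
    rw [sub_zero] at e1
    rw [zero_sub, abs_neg] at e2
    calc ENNReal.ofReal |(w (γ.toFun 0)).toReal - (w (γ.toFun γ.length)).toReal|
        ≤ ENNReal.ofReal (|S (γ.toFun 0)| + |S (γ.toFun γ.length)|) := by
          refine ENNReal.ofReal_le_ofReal ((abs_sub _ _).trans (add_le_add ?_ ?_))
          · exact (hbd 0 m0).2.trans (le_abs_self _)
          · exact (hbd _ ml).2.trans (le_abs_self _)
      _ ≤ (∫⁻ τ in Icc 0 z, G (γ.toFun τ)) + ∫⁻ τ in Icc z γ.length, G (γ.toFun τ) := by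
          rw [ENNReal.ofReal_add (abs_nonneg _) (abs_nonneg _)]
          exact add_le_add e1 e2
      _ = ∫⁻ τ in Icc 0 γ.length, G (γ.toFun τ) := by
          rw [← setLIntegral_congr (Ioc_ae_eq_Icc (a := z) (b := γ.length)),
            ← lintegral_union measurableSet_Ioc, Icc_union_Ioc_eq_Icc hz.1 hz.2]
          exact disjoint_left.2 fun x hx hx' => not_lt_of_ge hx.2 hx'.1
      _ ≤ _ := lintegral_mono fun t => le_add_self

variable [BorelSpace X]

theorem IsLpWeakUpperGradient.eventually_acBound (h : IsLpWeakUpperGradient μ p E u g)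
    (hp : 1 < p) (hE : MeasurableSet E) :
    ∀ᶠ γ in curveFilter μ p, γ.IsIn E → ACBound γ u g :=
  h.weak.eventually_acBound (zero_lt_one.trans hp) hE h.lt_top

theorem MemDirichlet.isLpWeakUpperGradient (h : MemDirichlet μ p E u) (hp : 1 < p)
    (hE : MeasurableSet E) : IsLpWeakUpperGradient μ p E u (minimalGradient μ p E u) :=
  ⟨(h.minimalGradient_spec (zero_lt_one.trans hp) hE).1,
    (h.minimalGradient_spec (zero_lt_one.trans hp) hE).2.1⟩

/-- Almost every curve in `E` stays where both functions are finite, so values of `v` elsewhere are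
irrelevant. The resulting gradient is crude: it is used for absolute continuity and sharpened
afterwards by `of_pieces`. -/
theorem IsLpWeakUpperGradient.comp (hp : 1 < p) (hE : MeasurableSet E)
    (h : IsLpWeakUpperGradient μ p E u g) (h' : IsLpWeakUpperGradient μ p E u' g') {φ : ℝ → ℝ → ℝ}
    (hφ : ∀ a b a' b', |φ a b - φ a' b'| ≤ |a - a'| + |b - b'|)
    (hv : ∀ x ∈ E, x ∈ finiteSet u u' → v x = φ (u x).toReal (u' x).toReal) :
    IsLpWeakUpperGradient μ p E v fun x => g x + g' x := by
  refine ⟨isWeakUpperGradient_of_eventually (zero_lt_one.trans hp) (h.weak.1.add h'.weak.1) ?_,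
    ENNReal.lintegral_rpow_add_lt_top_of_lintegral_rpow_lt_top h.weak.1 h.lt_top h'.lt_top hp.le⟩
  filter_upwards [h.eventually_acBound hp hE, h'.eventually_acBound hp hE] with γ h1 h2 hin
  have m0 : (0 : ℝ) ∈ Icc 0 γ.length := ⟨le_rfl, γ.length_pos.le⟩
  have ml : γ.length ∈ Icc 0 γ.length := ⟨γ.length_pos.le, le_rfl⟩
  unfold UpperGradientIneq
  rw [hv _ (hin _ m0) ⟨(h1 hin).finite _ m0, (h2 hin).finite _ m0⟩,
    hv _ (hin _ ml) ⟨(h1 hin).finite _ ml, (h2 hin).finite _ ml⟩,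
    gap_of_ne (by simp) (by simp), EReal.toReal_coe, EReal.toReal_coe]
  refine (ENNReal.ofReal_le_ofReal (hφ _ _ _ _)).trans ?_
  rw [ENNReal.ofReal_add (abs_nonneg _) (abs_nonneg _)]
  exact (add_le_add ((h1 hin).le_lintegral le_rfl γ.length_pos.le le_rfl)
    ((h2 hin).le_lintegral le_rfl γ.length_pos.le le_rfl)).trans (le_lintegral_add _ _)

/-- The gradient `g` only provides absolute continuity of `v`; the bound by `G` is then checked
pointwise on a set `F` that contains almost every curve. -/
theorem IsLpWeakUpperGradient.of_pieces {ι : Type*} [Countable ι] (hp : 1 < p)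
    (hE : MeasurableSet E) (h : IsLpWeakUpperGradient μ p E v g) {k : ι → X → ℝ}
    {gk : ι → X → ℝ≥0∞}
    (hk : ∀ i, ∀ᶠ γ in curveFilter μ p, γ.IsIn E → DerivBound γ (k i) (gk i)) {F : Set X}
    (hF : ∀ᶠ γ in curveFilter μ p, γ.IsIn E → ∀ t ∈ Icc 0 γ.length, γ.toFun t ∈ F)
    (hG : AEMeasurable G (μ.restrict E))
    (hcov : ∀ x ∈ E, x ∈ F → ∃ i, (v x).toReal = k i x ∧ gk i x ≤ G x) :
    IsWeakUpperGradient μ p E v G := by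
  have hp0 := zero_lt_one.trans hp
  have := countableInterFilter_curveFilter (X := X) (μ := μ) hp0
  refine isWeakUpperGradient_of_eventually hp0 hG ?_
  filter_upwards [h.eventually_acBound hp hE, eventually_countable_forall.2 hk, hF]
    with γ h1 h2 h3 hin
  exact ((h1 hin).of_pieces (fun i => h2 i hin)
    fun t ht => hcov _ (hin t ht) (h3 hin t ht)).upperGradientIneq

/-- The curve may leave `Ω`, but a short subcurve around a time with value in `Ω` does not, and
finiteness holds along that subcurve. -/
theorem IsLpWeakUpperGradient.eventually_finite (hp : 1 < p) (hΩ : IsOpen Ω)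
    (h : IsLpWeakUpperGradient μ p Ω u g) :
    ∀ᶠ γ in curveFilter μ p, ∀ t ∈ Icc 0 γ.length, γ.toFun t ∈ Ω →
      u (γ.toFun t) ≠ ⊤ ∧ u (γ.toFun t) ≠ ⊥ := by
  filter_upwards [eventually_sub (zero_lt_one.trans hp)
    (h.eventually_acBound hp hΩ.measurableSet)] with γ hγ t ht hmem
  obtain ⟨δ, hδ, hin⟩ := γ.exists_forall_mem hΩ ht hmem
  have hl := γ.length_pos
  set a := max (t - δ / 2) 0
  set b := min (t + δ / 2) γ.length
  have ha0 : 0 ≤ a := le_max_right _ _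
  have hbl : b ≤ γ.length := min_le_right _ _
  have hat : a ≤ t := max_le (by linarith) ht.1
  have htb : t ≤ b := le_min (by linarith) ht.2
  have hab : a < b := by
    refine max_lt (lt_min ?_ ?_) (lt_min ?_ hl) <;> linarith [ht.1, ht.2]
  have ha : t - δ / 2 ≤ a := le_max_left _ _
  have hb : b ≤ t + δ / 2 := min_le_left _ _
  have := (hγ a b ha0 hab hbl (fun τ hτ => by
    have h1 := hτ.1
    have h2 : τ ≤ b - a := hτ.2
    refine hin (a + τ) ⟨by linarith, by linarith⟩ (abs_lt.2 ⟨?_, ?_⟩) <;> linarith)).finite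
    (t - a) ⟨by linarith, by simp only [Curve.sub_length]; linarith⟩
  simpa using this

/-- The sum of the absolute values of finitely many (extended) functions in `D^p_0(Ω)`. -/
theorem exists_bound_of_memDirichletZero (hp : 1 < p) {d₁ d₂ d₃ : X → EReal}
    (h₁ : MemDirichletZero μ p Ω d₁) (h₂ : MemDirichletZero μ p Ω d₂)
    (h₃ : MemDirichletZero μ p Ω d₃) :
    ∃ (S : X → ℝ) (G : X → ℝ≥0∞), (∀ x ∉ Ω, S x = 0) ∧
      (∀ x ∈ Ω, S x = |(d₁ x).toReal| + |(d₂ x).toReal| + |(d₃ x).toReal|) ∧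
      AEMeasurable G μ ∧ ∫⁻ x, G x ^ p ∂μ < ∞ ∧
      ∀ᶠ γ in curveFilter μ p, ∀ s t, 0 ≤ s → s ≤ t → t ≤ γ.length →
        ENNReal.ofReal |S (γ.toFun s) - S (γ.toFun t)| ≤ ∫⁻ τ in Icc s t, G (γ.toFun τ) := by
  obtain ⟨w₁, hw₁, z₁, e₁⟩ := h₁
  obtain ⟨w₂, hw₂, z₂, e₂⟩ := h₂
  obtain ⟨w₃, hw₃, z₃, e₃⟩ := h₃
  have l₁ := hw₁.isLpWeakUpperGradient hp .univ
  have l₂ := hw₂.isLpWeakUpperGradient hp .univ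
  have l₃ := hw₃.isLpWeakUpperGradient hp .univ
  set g₁ := minimalGradient μ p univ w₁
  set g₂ := minimalGradient μ p univ w₂
  set g₃ := minimalGradient μ p univ w₃
  have hr : μ.restrict univ = μ := Measure.restrict_univ
  refine ⟨fun x => |(w₁ x).toReal| + |(w₂ x).toReal| + |(w₃ x).toReal|,
    fun x => g₁ x + g₂ x + g₃ x, ?_, ?_, ?_, ?_, ?_⟩
  · intro x hx
    simp [z₁ x hx, z₂ x hx, z₃ x hx]
  · intro x hx
    simp only [e₁ x hx, e₂ x hx, e₃ x hx]
  · have := (l₁.weak.1.add l₂.weak.1).add l₃.weak.1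
    rwa [hr] at this
  · have i₁ := l₁.lt_top
    have i₂ := l₂.lt_top
    have i₃ := l₃.lt_top
    have m₁ := l₁.weak.1
    have m₂ := l₂.weak.1
    rw [hr] at i₁ i₂ i₃ m₁ m₂
    exact ENNReal.lintegral_rpow_add_lt_top_of_lintegral_rpow_lt_top (m₁.add m₂)
      (ENNReal.lintegral_rpow_add_lt_top_of_lintegral_rpow_lt_top m₁ i₁ i₂ hp.le) i₃ hp.le
  · filter_upwards [l₁.eventually_acBound hp .univ, l₂.eventually_acBound hp .univ,
      l₃.eventually_acBound hp .univ] with γ a₁ a₂ a₃ s t hs hst ht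
    have b₁ := (a₁ fun _ _ => mem_univ _).le_lintegral hs hst ht
    have b₂ := (a₂ fun _ _ => mem_univ _).le_lintegral hs hst ht
    have b₃ := (a₃ fun _ _ => mem_univ _).le_lintegral hs hst ht
    refine le_trans (ENNReal.ofReal_le_ofReal (q := _ + _ + _) ?_)
      ((ENNReal.ofReal_add_le.trans (add_le_add ENNReal.ofReal_add_le le_rfl)).trans
      ((add_le_add (add_le_add b₁ b₂) b₃).trans
      ((add_le_add (le_lintegral_add _ _) le_rfl).trans (le_lintegral_add _ _))))
    set A := (w₁ (γ.toFun s)).toReal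
    set A' := (w₁ (γ.toFun t)).toReal
    set B := (w₂ (γ.toFun s)).toReal
    set B' := (w₂ (γ.toFun t)).toReal
    set C := (w₃ (γ.toFun s)).toReal
    set C' := (w₃ (γ.toFun t)).toReal
    have c₁ := abs_abs_sub_abs_le A A'
    have c₂ := abs_abs_sub_abs_le B B'
    have c₃ := abs_abs_sub_abs_le C C'
    calc |(|A| + |B| + |C|) - (|A'| + |B'| + |C'|)|
        = |(|A| - |A'|) + (|B| - |B'|) + (|C| - |C'|)| := by ring_nf
      _ ≤ |(|A| - |A'|)| + |(|B| - |B'|)| + |(|C| - |C'|)| := abs_add_three _ _ _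
      _ ≤ _ := by linarith

end Calculus

/-! ### Locally constant functions on an interval -/

/-- A continuous function that is locally constant where it does not vanish is constant if it does
not vanish at the left endpoint. -/
theorem eq_of_locally_const {k : ℝ → ℝ} {l : ℝ} (hl : 0 ≤ l) (hc : ContinuousOn k (Icc 0 l))
    (hloc : ∀ t ∈ Icc 0 l, k t ≠ 0 → ∃ δ > 0, ∀ s ∈ Icc 0 l, |s - t| < δ → k s = k t)
    (h0 : k 0 ≠ 0) : k l = k 0 := by
  have hcl : IsClosed ({t | k t = k 0} ∩ Icc 0 l) := by
    have := hc.preimage_isClosed_of_isClosed isClosed_Icc (isClosed_singleton (x := k 0))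
    rwa [inter_comm] at this
  refine hcl.Icc_subset_of_forall_mem_nhdsWithin (by simp) ?_ ⟨hl, le_rfl⟩
  rintro t ⟨ht, htm⟩
  have ht' : k t = k 0 := ht
  obtain ⟨δ, hδ, h⟩ := hloc t ⟨htm.1, htm.2.le⟩ (by rwa [ht'])
  have hlt : t < min (t + δ) l := lt_min (by linarith) htm.2
  filter_upwards [Ioo_mem_nhdsGT hlt] with s hs
  have h1 := hs.1
  have h2 : s < t + δ := hs.2.trans_le (min_le_left _ _)
  have h3 : s < l := hs.2.trans_le (min_le_right _ _)
  exact (h s ⟨htm.1.trans h1.le, h3.le⟩ (abs_lt.2 ⟨by linarith, by linarith⟩)).trans ht'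

theorem ne_zero_iff_of_locally_const {k : ℝ → ℝ} {l : ℝ} (hl : 0 ≤ l)
    (hc : ContinuousOn k (Icc 0 l))
    (hloc : ∀ t ∈ Icc 0 l, k t ≠ 0 → ∃ δ > 0, ∀ s ∈ Icc 0 l, |s - t| < δ → k s = k t) :
    k 0 ≠ 0 ↔ k l ≠ 0 := by
  constructor
  · intro h
    rwa [eq_of_locally_const hl hc hloc h]
  · intro h
    have hmaps : ∀ t ∈ Icc 0 l, l - t ∈ Icc 0 l := fun t ht => ⟨by linarith [ht.2], by linarith [ht.1]⟩
    have := eq_of_locally_const (k := fun t => k (l - t)) hl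
      (hc.comp (by fun_prop) hmaps) (fun t ht hk => by
        obtain ⟨δ, hδ, hd⟩ := hloc _ (hmaps t ht) hk
        refine ⟨δ, hδ, fun s hs hst => hd _ (hmaps s hs) ?_⟩
        rwa [sub_sub_sub_cancel_left, abs_sub_comm]) (by simpa using h)
    simp only [sub_self, sub_zero] at this
    rwa [this]

/-! ### Integral inequalities -/

section Integrals

variable {α : Type*} [MeasurableSpace α] {ν : Measure α} {p : ℝ}

theorem half_add_half_rpow_le (hp : 1 ≤ p) (x y : ℝ≥0∞) :
    ((x + y) / 2) ^ p ≤ (x ^ p + y ^ p) / 2 := by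
  have := ENNReal.rpow_arith_mean_le_arith_mean2_rpow 2⁻¹ 2⁻¹ x y ENNReal.inv_two_add_inv_two hp
  rwa [← mul_add, ← mul_add, mul_comm, mul_comm _ (x ^ p + y ^ p), ← div_eq_mul_inv,
    ← div_eq_mul_inv] at this

theorem eq_of_half_add_half_rpow_eq (hp : 1 < p) {x y : ℝ≥0∞} (hx : x ≠ ∞) (hy : y ≠ ∞)
    (h : ((x + y) / 2) ^ p = (x ^ p + y ^ p) / 2) : x = y := by
  have hp0 : 0 ≤ p := by linarith
  by_contra hne
  have hne' : x.toReal ≠ y.toReal := fun h' => hne ((ENNReal.toReal_eq_toReal_iff' hx hy).1 h')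
  have hs := (strictConvexOn_rpow hp).2 (show x.toReal ∈ Ici (0 : ℝ) from ENNReal.toReal_nonneg)
    (show y.toReal ∈ Ici (0 : ℝ) from ENNReal.toReal_nonneg) hne'
    (show (0 : ℝ) < 1 / 2 by norm_num) (show (0 : ℝ) < 1 / 2 by norm_num) (by norm_num)
  have h' := congrArg ENNReal.toReal h
  rw [← ENNReal.toReal_rpow, ENNReal.toReal_div, ENNReal.toReal_div, ENNReal.toReal_add hx hy,
    ENNReal.toReal_add (ENNReal.rpow_ne_top_of_nonneg hp0 hx)
      (ENNReal.rpow_ne_top_of_nonneg hp0 hy), ← ENNReal.toReal_rpow, ← ENNReal.toReal_rpow] at h'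
  simp only [smul_eq_mul, ENNReal.toReal_ofNat] at hs h'
  rw [show 1 / 2 * x.toReal + 1 / 2 * y.toReal = (x.toReal + y.toReal) / 2 by ring, h'] at hs
  linarith

/-- Uniqueness from strict convexity of the `p`-th power. -/
theorem ae_eq_of_lintegral_le_midpoint (hp : 1 < p) {a b : α → ℝ≥0∞} (ha : AEMeasurable a ν)
    (hb : AEMeasurable b ν) (hfin : ∫⁻ x, a x ^ p ∂ν < ∞)
    (hba : ∫⁻ x, b x ^ p ∂ν ≤ ∫⁻ x, a x ^ p ∂ν)
    (hab : ∫⁻ x, a x ^ p ∂ν ≤ ∫⁻ x, ((a x + b x) / 2) ^ p ∂ν) : a =ᵐ[ν] b := by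
  have hp0 : 0 < p := by linarith
  have hle : ∀ x, ((a x + b x) / 2) ^ p ≤ (a x ^ p + b x ^ p) / 2 := fun x =>
    half_add_half_rpow_le hp.le _ _
  have hav : ∫⁻ x, (a x ^ p + b x ^ p) / 2 ∂ν ≤ ∫⁻ x, a x ^ p ∂ν := by
    simp only [div_eq_mul_inv]
    rw [lintegral_mul_const' _ _ (by simp), lintegral_add_left' (ha.pow_const p), ← div_eq_mul_inv]
    refine (ENNReal.div_le_div_right (add_le_add le_rfl hba) 2).trans (le_of_eq ?_)
    rw [← two_mul, mul_div_assoc, ENNReal.mul_div_cancel two_ne_zero ENNReal.ofNat_ne_top]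
  -- The integral of `((a + b)/2)^p` lies between that of `a^p` and that of `(a^p + b^p)/2`, which
  -- in turn is at most that of `a^p`. So convexity holds with equality a.e.
  have heq := ae_eq_of_ae_le_of_lintegral_le (.of_forall hle)
    (((lintegral_mono hle).trans hav).trans_lt hfin).ne
    (((ha.pow_const p).add (hb.pow_const p)).div_const 2) (hav.trans hab)
  filter_upwards [heq, ae_lt_top' (ha.pow_const p) hfin.ne,
    ae_lt_top' (hb.pow_const p) (hba.trans_lt hfin).ne] with x h1 h2 h3
  refine eq_of_half_add_half_rpow_eq hp ?_ ?_ h1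
  · rintro h; simp [h, hp0] at h2
  · rintro h; simp [h, hp0] at h3

/-- Comparison of the energy of `g` with that of a competitor that equals `G` on `T`, `g` on `R`
and vanishes elsewhere. -/
theorem lintegral_le_of_le_indicator_add (hp : 0 < p) {g G : α → ℝ≥0∞} {T R Q : Set α}
    (hg : AEMeasurable g ν) (hT : NullMeasurableSet T ν) (hR : NullMeasurableSet R ν)
    (hQ : NullMeasurableSet Q ν) (hTR : Disjoint T R) (hQR : Disjoint Q R)
    (hfin : ∫⁻ x, g x ^ p ∂ν < ∞)
    (h : ∫⁻ x, g x ^ p ∂ν ≤ ∫⁻ x, (T.indicator G x + R.indicator g x) ^ p ∂ν) :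
    ∫⁻ x in Q, g x ^ p ∂ν ≤ ∫⁻ x in T, G x ^ p ∂ν := by
  have hRm : AEMeasurable (R.indicator fun x => g x ^ p) ν := (hg.pow_const p).indicator₀ hR
  have h1 : ∀ x, (T.indicator G x + R.indicator g x) ^ p =
      T.indicator (fun x => G x ^ p) x + R.indicator (fun x => g x ^ p) x := by
    intro x
    by_cases hx : x ∈ T
    · have hx' : x ∉ R := disjoint_left.1 hTR hx
      simp [hx, hx']
    · by_cases hx' : x ∈ R <;> simp [hx, hx', hp]
  have h2 : ∀ x, Q.indicator (fun x => g x ^ p) x + R.indicator (fun x => g x ^ p) x ≤ g x ^ p := by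
    intro x
    by_cases hx : x ∈ Q
    · have hx' : x ∉ R := disjoint_left.1 hQR hx
      simp [hx, hx']
    · by_cases hx' : x ∈ R <;> simp [hx, hx']
  simp_rw [h1] at h
  have h3 := (lintegral_mono h2).trans h
  rw [lintegral_add_right' _ hRm, lintegral_add_right' _ hRm, lintegral_indicator₀ hQ,
    lintegral_indicator₀ hR, lintegral_indicator₀ hT] at h3
  -- The contribution of `R` is the same on both sides and finite, so it cancels.
  exact (ENNReal.add_le_add_iff_right
    (ne_top_of_le_ne_top hfin.ne (setLIntegral_le_lintegral _ _))).1 h3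

end Integrals

/-! ### Admissible functions in obstacle problems -/

theorem coe_toReal_sub {a b : EReal} (ha : a ≠ ⊤ ∧ a ≠ ⊥) (hb : b ≠ ⊤ ∧ b ≠ ⊥) :
    a - b = ((a.toReal - b.toReal : ℝ) : EReal) := by
  rw [EReal.coe_sub, EReal.coe_toReal ha.1 ha.2, EReal.coe_toReal hb.1 hb.2]

theorem toReal_mono_of_finite {a b : EReal} (ha : a ≠ ⊤ ∧ a ≠ ⊥) (hb : b ≠ ⊤ ∧ b ≠ ⊥)
    (h : a ≤ b) : a.toReal ≤ b.toReal := EReal.toReal_le_toReal h ha.2 hb.1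

theorem nullMeasurableSet_finiteSet {X : Type*} [MeasurableSpace X] {ν : Measure X}
    {u₁ u₂ : X → EReal} (h₁ : AEMeasurable u₁ ν)
    (h₂ : AEMeasurable u₂ ν) : NullMeasurableSet (finiteSet u₁ u₂) ν := by
  have hm : MeasurableSet {a : EReal | a ≠ ⊤ ∧ a ≠ ⊥} :=
    ((measurableSet_singleton _).compl.inter (measurableSet_singleton _).compl)
  exact (h₁.nullMeasurable hm).inter (h₂.nullMeasurable hm)

section Comparison

variable {X : Type*} [MetricSpace X] [MeasurableSpace X] [BorelSpace X] {μ : Measure X} {p : ℝ}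
  {Ω : Set X} {u₁ u₂ f₁ f₂ : X → EReal} {g₁ g₂ : X → ℝ≥0∞}

theorem IsWeakUpperGradient.congr_ae (hp : 0 < p) {E : Set X} (hE : MeasurableSet E)
    {u : X → EReal} {g g' : X → ℝ≥0∞} (h : IsWeakUpperGradient μ p E u g)
    (hgg : g =ᵐ[μ.restrict E] g') : IsWeakUpperGradient μ p E u g' := by
  refine isWeakUpperGradient_of_eventually hp (h.1.congr hgg) ?_
  filter_upwards [(weakUpperGradient_modulus_iff hp).1 h.2,
    eventually_ae_of_ae_restrict hp hE hgg] with γ h1 h2 hin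
  exact (h1 hin).trans (lintegral_congr_ae (h2 hin)).le

/-- A function with a weak upper gradient in `L^p(Ω)` that is dominated along curves by a suitable
function vanishing outside `Ω`, belongs to `D^p_0(Ω)`. -/
theorem memDirichletZero_sub (hp : 1 < p) (hΩ : IsOpen Ω) {v f : X → EReal}
    {gv gf G : X → ℝ≥0∞} {S : X → ℝ} (hvm : AEMeasurable v (μ.restrict Ω))
    (hfm : AEMeasurable f (μ.restrict Ω)) (hv : IsLpWeakUpperGradient μ p Ω v gv)
    (hf : IsLpWeakUpperGradient μ p Ω f gf) (hS0 : ∀ x ∉ Ω, S x = 0)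
    (hGm : AEMeasurable G μ) (hGi : ∫⁻ x, G x ^ p ∂μ < ∞)
    (hS : ∀ᶠ γ in curveFilter μ p, ∀ s t, 0 ≤ s → s ≤ t → t ≤ γ.length →
      ENNReal.ofReal |S (γ.toFun s) - S (γ.toFun t)| ≤ ∫⁻ τ in Icc s t, G (γ.toFun τ))
    (hle : ∀ᶠ γ in curveFilter μ p, ∀ t ∈ Icc 0 γ.length, γ.toFun t ∈ Ω →
      |(v (γ.toFun t)).toReal - (f (γ.toFun t)).toReal| ≤ S (γ.toFun t)) :
    MemDirichletZero μ p Ω fun x => v x - f x := by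
  classical
  set w : X → EReal := Ω.indicator fun x => v x - f x with hw
  have hd := hv.comp hp hΩ.measurableSet hf (φ := fun a b => a - b) (v := fun x => v x - f x)
    (fun a b a' b' => by
      rw [show a - b - (a' - b') = (a - a') - (b - b') by ring]
      exact abs_sub _ _) (fun x _ hx => coe_toReal_sub hx.1 hx.2)
  have hdm : AEMeasurable (fun x => v x - f x) (μ.restrict Ω) := by
    simp only [sub_eq_add_neg]
    exact hvm.add (continuous_neg.measurable.comp_aemeasurable hfm)
  obtain ⟨H, hH⟩ := hd.extend_zero hp hΩ.measurableSet (w := w)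
    (fun x hx => indicator_of_mem hx _) (fun x hx => indicator_of_notMem hx _) hS0 hGm hGi hS (by
      filter_upwards [hle, hv.eventually_finite hp hΩ, hf.eventually_finite hp hΩ]
        with γ h1 h2 h3 t ht hm
      rw [coe_toReal_sub (h2 t ht hm) (h3 t ht hm), EReal.toReal_coe]
      exact ⟨⟨EReal.coe_ne_top _, EReal.coe_ne_bot _⟩, h1 t ht hm⟩)
  refine ⟨w, hH.weak.memDirichlet (zero_lt_one.trans hp) .univ ?_ hH.lt_top,
    fun x hx => indicator_of_notMem hx _, fun x hx => indicator_of_mem hx _⟩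
  rw [Measure.restrict_univ]
  exact (aemeasurable_indicator_iff hΩ.measurableSet).2 hdm

/-- The dominating function for differences of solutions and boundary data. -/
theorem exists_dominating_function (hp : 1 < p) (hΩ : IsOpen Ω)
    (hu₁ : MemDirichlet μ p Ω u₁) (hu₂ : MemDirichlet μ p Ω u₂)
    (hf₁ : MemDirichlet μ p Ω f₁) (hf₂ : MemDirichlet μ p Ω f₂)
    (h₁ : MemDirichletZero μ p Ω fun x => u₁ x - f₁ x)
    (h₂ : MemDirichletZero μ p Ω fun x => u₂ x - f₂ x)
    (hf : MemDirichletZero μ p Ω fun x => max (f₁ x - f₂ x) 0) :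
    ∃ (S : X → ℝ) (G : X → ℝ≥0∞), (∀ x ∉ Ω, S x = 0) ∧ AEMeasurable G μ ∧
      ∫⁻ x, G x ^ p ∂μ < ∞ ∧
      (∀ᶠ γ in curveFilter μ p, ∀ s t, 0 ≤ s → s ≤ t → t ≤ γ.length →
        ENNReal.ofReal |S (γ.toFun s) - S (γ.toFun t)| ≤ ∫⁻ τ in Icc s t, G (γ.toFun τ)) ∧
      ∀ᶠ γ in curveFilter μ p, ∀ t ∈ Icc 0 γ.length, γ.toFun t ∈ Ω →
        γ.toFun t ∈ finiteSet u₁ u₂ ∧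
        S (γ.toFun t) = |(u₁ (γ.toFun t)).toReal - (f₁ (γ.toFun t)).toReal| +
          |(u₂ (γ.toFun t)).toReal - (f₂ (γ.toFun t)).toReal| +
          max ((f₁ (γ.toFun t)).toReal - (f₂ (γ.toFun t)).toReal) 0 := by
  obtain ⟨S, G, hS0, hSΩ, hGm, hGi, hS⟩ := exists_bound_of_memDirichletZero hp h₁ h₂ hf
  refine ⟨S, G, hS0, hGm, hGi, hS, ?_⟩
  have hm := hΩ.measurableSet
  filter_upwards [(hu₁.isLpWeakUpperGradient hp hm).eventually_finite hp hΩ,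
    (hu₂.isLpWeakUpperGradient hp hm).eventually_finite hp hΩ,
    (hf₁.isLpWeakUpperGradient hp hm).eventually_finite hp hΩ,
    (hf₂.isLpWeakUpperGradient hp hm).eventually_finite hp hΩ] with γ a₁ a₂ b₁ b₂ t ht hmem
  refine ⟨⟨a₁ t ht hmem, a₂ t ht hmem⟩, ?_⟩
  rw [hSΩ _ hmem, coe_toReal_sub (a₁ t ht hmem) (b₁ t ht hmem),
    coe_toReal_sub (a₂ t ht hmem) (b₂ t ht hmem), coe_toReal_sub (b₁ t ht hmem) (b₂ t ht hmem),
    ← EReal.coe_zero, ← EReal.coe_strictMono.monotone.map_max, EReal.toReal_coe, EReal.toReal_coe,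
    EReal.toReal_coe, abs_of_nonneg (a := max _ _) (le_max_right _ _)]

/-- Such a `v` is admissible for the second problem. It lies above `u₂`, hence above the obstacle,
and `|v - f₂|` is at most the dominating function because `u₁ - f₂ = (u₁ - f₁) + (f₁ - f₂)`. -/
theorem IsObstacleSolution.lintegral_le_of_between_max (hp : 1 < p) (hΩ : IsOpen Ω)
    {ψ₂ : X → EReal} (hf₁ : MemDirichlet μ p Ω f₁) (hf₂ : MemDirichlet μ p Ω f₂)
    (hu₁ : MemDirichlet μ p Ω u₁) (h₁ : MemDirichletZero μ p Ω fun x => u₁ x - f₁ x)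
    (hu₂ : IsObstacleSolution μ p Ω ψ₂ f₂ u₂)
    (hf : MemDirichletZero μ p Ω fun x => max (f₁ x - f₂ x) 0)
    {v : X → EReal} {g G : X → ℝ≥0∞} (hvm : AEMeasurable v (μ.restrict Ω))
    (hv : IsLpWeakUpperGradient μ p Ω v g) (hle : ∀ x, u₂ x ≤ v x)
    (hle' : ∀ x, v x ≤ max (u₁ x) (u₂ x)) (hG : IsWeakUpperGradient μ p Ω v G) :
    ∫⁻ x in Ω, minimalGradient μ p Ω u₂ x ^ p ∂μ ≤ ∫⁻ x in Ω, G x ^ p ∂μ := by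
  have hp0 := zero_lt_one.trans hp
  have hm := hΩ.measurableSet
  refine (hu₂.2 v ⟨hv.weak.memDirichlet hp0 hm hvm hv.lt_top, ?_, ?_⟩).trans
    (energy_le hp0 hm hvm hG)
  · obtain ⟨S, D, hS0, hDm, hDi, hS, hSle⟩ :=
      exists_dominating_function hp hΩ hu₁ hu₂.1.1 hf₁ hf₂ h₁ hu₂.1.2.1 hf
    refine memDirichletZero_sub hp hΩ hvm hf₂.1 hv (hf₂.isLpWeakUpperGradient hp hm) hS0 hDm hDi hS
      ?_
    filter_upwards [hSle, hv.eventually_finite hp hΩ] with γ h2 h3 t ht hmem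
    obtain ⟨⟨c₁, c₂⟩, hSeq⟩ := h2 t ht hmem
    have c := h3 t ht hmem
    rw [hSeq]
    have e1 := toReal_mono_of_finite c₂ c (hle (γ.toFun t))
    have e2 : (v (γ.toFun t)).toReal ≤ max (u₁ (γ.toFun t)).toReal (u₂ (γ.toFun t)).toReal := by
      rcases le_max_iff.1 (hle' (γ.toFun t)) with h | h
      · exact (toReal_mono_of_finite c c₁ h).trans (le_max_left _ _)
      · exact (toReal_mono_of_finite c c₂ h).trans (le_max_right _ _)
    generalize (v (γ.toFun t)).toReal = V at *
    generalize (u₁ (γ.toFun t)).toReal = U₁ at *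
    generalize (u₂ (γ.toFun t)).toReal = U₂ at *
    generalize (f₁ (γ.toFun t)).toReal = F₁ at *
    generalize (f₂ (γ.toFun t)).toReal = F₂ at *
    have k1 := abs_le.1 (le_refl |U₁ - F₁|)
    have k2 := abs_le.1 (le_refl |U₂ - F₂|)
    have k3 := le_max_left (F₁ - F₂) 0
    have k4 := le_max_right (F₁ - F₂) 0
    have k5 := abs_nonneg (U₁ - F₁)
    have k6 := abs_nonneg (U₂ - F₂)
    refine abs_le.2 ⟨by linarith, ?_⟩
    rcases le_max_iff.1 e2 with h | h <;> linarith
  · refine capacity_eq_zero_of_subset ?_ hu₂.1.2.2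
    exact fun x hx => ⟨hx.1, fun h => hx.2 (h.trans (hle x))⟩

/-- Such a `v` is admissible for the first problem. Both `u₁` and `u₂` lie above `ψ₁` q.e., the
latter through `ψ₂`, and the lower bound for `v - f₁` uses `u₂ - f₁ = (u₂ - f₂) - (f₁ - f₂)`. -/
theorem IsObstacleSolution.lintegral_le_of_min_between (hp : 1 < p) (hΩ : IsOpen Ω)
    {ψ₁ ψ₂ : X → EReal} (hf₁ : MemDirichlet μ p Ω f₁) (hf₂ : MemDirichlet μ p Ω f₂)
    (hu₁ : IsObstacleSolution μ p Ω ψ₁ f₁ u₁) (hu₂ : u₂ ∈ obstacleClass μ p Ω ψ₂ f₂)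
    (hψ : QuasieverywhereIn μ p Ω fun x => ψ₁ x ≤ ψ₂ x)
    (hf : MemDirichletZero μ p Ω fun x => max (f₁ x - f₂ x) 0)
    {v : X → EReal} {g G : X → ℝ≥0∞} (hvm : AEMeasurable v (μ.restrict Ω))
    (hv : IsLpWeakUpperGradient μ p Ω v g) (hle : ∀ x, min (u₁ x) (u₂ x) ≤ v x)
    (hle' : ∀ x, v x ≤ u₁ x) (hG : IsWeakUpperGradient μ p Ω v G) :
    ∫⁻ x in Ω, minimalGradient μ p Ω u₁ x ^ p ∂μ ≤ ∫⁻ x in Ω, G x ^ p ∂μ := by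
  have hp0 := zero_lt_one.trans hp
  have hm := hΩ.measurableSet
  refine (hu₁.2 v ⟨hv.weak.memDirichlet hp0 hm hvm hv.lt_top, ?_, ?_⟩).trans
    (energy_le hp0 hm hvm hG)
  · obtain ⟨S, D, hS0, hDm, hDi, hS, hSle⟩ :=
      exists_dominating_function hp hΩ hu₁.1.1 hu₂.1 hf₁ hf₂ hu₁.1.2.1 hu₂.2.1 hf
    refine memDirichletZero_sub hp hΩ hvm hf₁.1 hv (hf₁.isLpWeakUpperGradient hp hm) hS0 hDm hDi hS
      ?_
    filter_upwards [hSle, hv.eventually_finite hp hΩ] with γ h2 h3 t ht hmem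
    obtain ⟨⟨c₁, c₂⟩, hSeq⟩ := h2 t ht hmem
    have c := h3 t ht hmem
    rw [hSeq]
    have e1 := toReal_mono_of_finite c c₁ (hle' (γ.toFun t))
    have e2 : min (u₁ (γ.toFun t)).toReal (u₂ (γ.toFun t)).toReal ≤ (v (γ.toFun t)).toReal := by
      rcases min_le_iff.1 (hle (γ.toFun t)) with h | h
      · exact (min_le_left _ _).trans (toReal_mono_of_finite c₁ c h)
      · exact (min_le_right _ _).trans (toReal_mono_of_finite c₂ c h)
    generalize (v (γ.toFun t)).toReal = V at *
    generalize (u₁ (γ.toFun t)).toReal = U₁ at *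
    generalize (u₂ (γ.toFun t)).toReal = U₂ at *
    generalize (f₁ (γ.toFun t)).toReal = F₁ at *
    generalize (f₂ (γ.toFun t)).toReal = F₂ at *
    have k1 := abs_le.1 (le_refl |U₁ - F₁|)
    have k2 := abs_le.1 (le_refl |U₂ - F₂|)
    have k3 := le_max_left (F₁ - F₂) 0
    have k4 := le_max_right (F₁ - F₂) 0
    have k5 := abs_nonneg (U₁ - F₁)
    have k6 := abs_nonneg (U₂ - F₂)
    refine abs_le.2 ⟨?_, by linarith⟩
    rcases min_le_iff.1 e2 with h | h <;> linarith
  · refine capacity_eq_zero_of_subset (B := {x | x ∈ Ω ∧ ¬ ψ₁ x ≤ u₁ x} ∪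
      ({x | x ∈ Ω ∧ ¬ ψ₁ x ≤ ψ₂ x} ∪ {x | x ∈ Ω ∧ ¬ ψ₂ x ≤ u₂ x})) ?_
      (capacity_union_eq_zero hp0 hu₁.1.2.2 (capacity_union_eq_zero hp0 hψ hu₂.2.2))
    rintro x ⟨hx, hxn⟩
    by_contra hcon
    simp only [mem_union, mem_ofPred_eq, not_or, not_and, not_not] at hcon
    obtain ⟨n1, n2, n3⟩ := hcon
    exact hxn ((le_min (n1 hx) ((n2 hx).trans (n3 hx))).trans (hle x))

end Comparison

/-! ### Energy minimizers -/

theorem coe_toReal_eq {a : EReal} (ha : a ≠ ⊤ ∧ a ≠ ⊥) : a = (a.toReal : EReal) :=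
  (EReal.coe_toReal ha.1 ha.2).symm

theorem toReal_lt_iff {a b : EReal} (ha : a ≠ ⊤ ∧ a ≠ ⊥) (hb : b ≠ ⊤ ∧ b ≠ ⊥) :
    a.toReal < b.toReal ↔ a < b := by
  conv_rhs => rw [coe_toReal_eq ha, coe_toReal_eq hb, EReal.coe_lt_coe_iff]

/-- The average of `u₁` and `min u₁ u₂`, with values between these two functions also where they
are infinite. -/
noncomputable def midpointMin {X : Type*} (u₁ u₂ : X → EReal) (x : X) : EReal :=
  max (min (u₁ x) (u₂ x))
    (min (u₁ x) ((((u₁ x).toReal + min (u₁ x).toReal (u₂ x).toReal) / 2 : ℝ) : EReal))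

theorem midpointMin_of_mem {X : Type*} {u₁ u₂ : X → EReal} {x : X} (hx : x ∈ finiteSet u₁ u₂) :
    midpointMin u₁ u₂ x = (((u₁ x).toReal + min (u₁ x).toReal (u₂ x).toReal) / 2 : ℝ) := by
  unfold midpointMin
  rw [coe_toReal_eq hx.1, coe_toReal_eq hx.2]
  simp only [EReal.toReal_coe]
  rw [← EReal.coe_strictMono.monotone.map_min, ← EReal.coe_strictMono.monotone.map_min,
    ← EReal.coe_strictMono.monotone.map_max]
  have h := min_le_left (u₁ x).toReal (u₂ x).toReal
  rw [min_eq_right (b := (_ + _) / 2) (by linarith), max_eq_right (by linarith)]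

section Gluing

variable {X : Type*} [MetricSpace X] [MeasurableSpace X] [BorelSpace X] {μ : Measure X} {p : ℝ}
  {E Ω : Set X} {u₁ u₂ : X → EReal} {g₁ g₂ : X → ℝ≥0∞}

/-- The subset of `finiteSet u₁ u₂` where `u₂ < u₁`. -/
def contactComplement (u₁ u₂ : X → EReal) : Set X := {x | x ∈ finiteSet u₁ u₂ ∧ u₂ x < u₁ x}

theorem IsLpWeakUpperGradient.eventually_mem_finiteSet (hp : 1 < p) (hE : MeasurableSet E)
    (h₁ : IsLpWeakUpperGradient μ p E u₁ g₁) (h₂ : IsLpWeakUpperGradient μ p E u₂ g₂) :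
    ∀ᶠ γ in curveFilter μ p, γ.IsIn E → ∀ t ∈ Icc 0 γ.length, γ.toFun t ∈ finiteSet u₁ u₂ := by
  filter_upwards [h₁.eventually_acBound hp hE, h₂.eventually_acBound hp hE] with γ a₁ a₂ hin t ht
    using ⟨(a₁ hin).finite t ht, (a₂ hin).finite t ht⟩

/-- Competitors `max u₂ (min u₁ c)` for a real number `c`. -/
theorem IsLpWeakUpperGradient.max_min_const (hp : 1 < p) (hE : MeasurableSet E)
    (h₁ : IsLpWeakUpperGradient μ p E u₁ g₁) (h₂ : IsLpWeakUpperGradient μ p E u₂ g₂) (c : ℝ) :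
    IsLpWeakUpperGradient μ p E (fun x => max (u₂ x) (min (u₁ x) c)) fun x => g₁ x + g₂ x := by
  refine h₁.comp hp hE h₂ (φ := fun a b => max b (min a c)) (fun a b a' b' => ?_) ?_
  · refine (abs_max_sub_max_le_max _ _ _ _).trans (max_le ?_ ?_)
    · linarith [abs_nonneg (a - a')]
    · refine (abs_min_sub_min_le_max _ _ _ _).trans (max_le ?_ ?_)
      · linarith [abs_nonneg (b - b')]
      · simp only [sub_self, abs_zero]; positivity
  · rintro x - ⟨c₁, c₂⟩
    rw [EReal.coe_strictMono.monotone.map_max, EReal.coe_strictMono.monotone.map_min,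
      ← coe_toReal_eq c₁, ← coe_toReal_eq c₂]

theorem IsLpWeakUpperGradient.max (hp : 1 < p) (hE : MeasurableSet E)
    (h₁ : IsLpWeakUpperGradient μ p E u₁ g₁) (h₂ : IsLpWeakUpperGradient μ p E u₂ g₂) :
    IsLpWeakUpperGradient μ p E (fun x => Max.max (u₁ x) (u₂ x)) fun x => g₁ x + g₂ x := by
  refine h₁.comp hp hE h₂ (φ := fun a b => Max.max a b) (fun a b a' b' => ?_) ?_
  · refine (abs_max_sub_max_le_max _ _ _ _).trans (max_le ?_ ?_)
    · linarith [abs_nonneg (b - b')]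
    · linarith [abs_nonneg (a - a')]
  · rintro x - ⟨c₁, c₂⟩
    rw [EReal.coe_strictMono.monotone.map_max, ← coe_toReal_eq c₁, ← coe_toReal_eq c₂]

theorem IsLpWeakUpperGradient.midpointMin (hp : 1 < p) (hE : MeasurableSet E)
    (h₁ : IsLpWeakUpperGradient μ p E u₁ g₁) (h₂ : IsLpWeakUpperGradient μ p E u₂ g₂) :
    IsLpWeakUpperGradient μ p E (midpointMin u₁ u₂) fun x => g₁ x + g₂ x := by
  refine h₁.comp hp hE h₂ (φ := fun a b => (a + min a b) / 2) (fun a b a' b' => ?_)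
    fun x _ hx => midpointMin_of_mem hx
  have h := (abs_min_sub_min_le_max a b a' b').trans
    (max_le_add_of_nonneg (abs_nonneg _) (abs_nonneg _))
  have h' := abs_add_le (a - a') (min a b - min a' b')
  rw [show (a + min a b) / 2 - (a' + min a' b') / 2 = ((a - a') + (min a b - min a' b')) / 2 by ring,
    abs_div, abs_two]
  linarith [abs_nonneg (b - b')]

/-- If `u₁` and `u₂` minimize the energy among the functions between `min u₁ u₂` and `u₁`, and
among those between `u₂` and `max u₁ u₂`, then their gradients vanish where `u₂ < u₁`. -/
theorem gradients_eq_zero (hp : 1 < p) (hE : MeasurableSet E)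
    (hm₁ : AEMeasurable u₁ (μ.restrict E)) (hm₂ : AEMeasurable u₂ (μ.restrict E))
    (h₁ : IsLpWeakUpperGradient μ p E u₁ g₁) (h₂ : IsLpWeakUpperGradient μ p E u₂ g₂)
    (hmin₁ : ∀ (v : X → EReal) (g G : X → ℝ≥0∞), AEMeasurable v (μ.restrict E) →
      IsLpWeakUpperGradient μ p E v g → (∀ x, min (u₁ x) (u₂ x) ≤ v x) → (∀ x, v x ≤ u₁ x) →
      IsWeakUpperGradient μ p E v G → ∫⁻ x in E, g₁ x ^ p ∂μ ≤ ∫⁻ x in E, G x ^ p ∂μ)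
    (hmin₂ : ∀ (v : X → EReal) (g G : X → ℝ≥0∞), AEMeasurable v (μ.restrict E) →
      IsLpWeakUpperGradient μ p E v g → (∀ x, u₂ x ≤ v x) → (∀ x, v x ≤ max (u₁ x) (u₂ x)) →
      IsWeakUpperGradient μ p E v G → ∫⁻ x in E, g₂ x ^ p ∂μ ≤ ∫⁻ x in E, G x ^ p ∂μ) :
    ∀ᵐ x ∂μ.restrict E, x ∈ contactComplement u₁ u₂ → g₁ x = 0 ∧ g₂ x = 0 := by
  have hp0 : 0 < p := zero_lt_one.trans hp
  set ν := μ.restrict E with hν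
  set A := contactComplement u₁ u₂ with hA
  set F := finiteSet u₁ u₂ with hF
  have hFm : NullMeasurableSet F ν := nullMeasurableSet_finiteSet hm₁ hm₂
  have hAm : NullMeasurableSet A ν := hFm.inter (nullMeasurableSet_lt hm₂ hm₁)
  have hFe := h₁.eventually_mem_finiteSet hp hE h₂
  have hgm₁ := h₁.weak.1
  have hgm₂ := h₂.weak.1
  have hk₁ : ∀ᶠ γ in curveFilter μ p, γ.IsIn E → DerivBound γ (fun x => (u₁ x).toReal) g₁ := by
    filter_upwards [h₁.eventually_acBound hp hE] with γ h hin using (h hin).derivBound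
  have hk₂ : ∀ᶠ γ in curveFilter μ p, γ.IsIn E → DerivBound γ (fun x => (u₂ x).toReal) g₂ := by
    filter_upwards [h₂.eventually_acBound hp hE] with γ h hin using (h hin).derivBound
  have hAF : Disjoint A (F \ A) := disjoint_sdiff_right
  -- comparison with the maximum
  have energy_le_max : ∫⁻ x in A, g₂ x ^ p ∂ν ≤ ∫⁻ x in A, g₁ x ^ p ∂ν := by
    refine lintegral_le_of_le_indicator_add hp0 hgm₂ hAm (hFm.diff hAm) hAm hAF hAF h₂.lt_top ?_
    refine hmin₂ _ _ _ (hm₁.max hm₂) (h₁.max hp hE h₂) (fun x => le_max_right _ _)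
      (fun x => le_rfl) ?_
    refine (h₁.max hp hE h₂).of_pieces hp hE
      (k := fun b : Bool => cond b (fun x => (u₁ x).toReal) fun x => (u₂ x).toReal)
      (gk := fun b => cond b g₁ g₂) (by rintro (_ | _); exacts [hk₂, hk₁]) hFe
      ((hgm₁.indicator₀ hAm).add (hgm₂.indicator₀ (hFm.diff hAm))) fun x _ hx => ?_
    by_cases hxA : x ∈ A
    · exact ⟨true, by simp [max_eq_left hxA.2.le], by simp [hxA]⟩
    · have : u₁ x ≤ u₂ x := not_lt.1 fun h => hxA ⟨hx, h⟩
      have hxR : x ∈ F \ A := ⟨hx, hxA⟩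
      exact ⟨false, by simp [max_eq_right this], by rw [indicator_of_mem hxR]; exact le_add_self⟩
  -- comparison with the midpoint
  have energy_le_midpoint : ∫⁻ x in A, g₁ x ^ p ∂ν ≤ ∫⁻ x in A, ((g₁ x + g₂ x) / 2) ^ p ∂ν := by
    refine lintegral_le_of_le_indicator_add (G := fun x => (g₁ x + g₂ x) / 2) hp0 hgm₁ hAm
      (hFm.diff hAm) hAm hAF hAF h₁.lt_top ?_
    have hvm : AEMeasurable (midpointMin u₁ u₂) ν :=
      (hm₁.min hm₂).max (hm₁.min
        ((hm₁.ereal_toReal.add (hm₁.ereal_toReal.min hm₂.ereal_toReal)).div_const 2).coe_real_ereal)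
    refine hmin₁ _ _ _ hvm (h₁.midpointMin hp hE h₂) (fun x => le_max_left _ _)
      (fun x => max_le (min_le_left _ _) (min_le_left _ _)) ?_
    refine (h₁.midpointMin hp hE h₂).of_pieces hp hE
      (k := fun b : Bool => cond b (fun x => ((u₁ x).toReal + (u₂ x).toReal) / 2)
        fun x => (u₁ x).toReal)
      (gk := fun b => cond b (fun x => (g₁ x + g₂ x) / 2) g₁) ?_ hFe
      ((((hgm₁.add hgm₂).div_const 2).indicator₀ hAm).add (hgm₁.indicator₀ (hFm.diff hAm)))
      fun x _ hx => ?_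
    · rintro (_ | _)
      · exact hk₁
      · filter_upwards [hk₁, hk₂] with γ a b hin using (a hin).midpoint (b hin)
    · by_cases hxA : x ∈ A
      · have := ((toReal_lt_iff hx.2 hx.1).2 hxA.2).le
        exact ⟨true, by simp [midpointMin_of_mem hx, min_eq_right this], by simp [hxA]⟩
      · have : u₁ x ≤ u₂ x := not_lt.1 fun h => hxA ⟨hx, h⟩
        have := toReal_mono_of_finite hx.1 hx.2 this
        have hxR : x ∈ F \ A := ⟨hx, hxA⟩
        exact ⟨false, by simp [midpointMin_of_mem hx, min_eq_left this],
          by rw [indicator_of_mem hxR]; exact le_add_self⟩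
  -- The two comparisons leave no slack in the convexity inequality, and strict convexity gives
  -- equality of the gradients.
  have heq : g₁ =ᵐ[ν.restrict A] g₂ :=
    ae_eq_of_lintegral_le_midpoint hp hgm₁.restrict hgm₂.restrict
      (lt_of_le_of_lt (setLIntegral_le_lintegral _ _) h₁.lt_top) energy_le_max energy_le_midpoint
  -- comparison with truncations at the level `c`
  have eq_zero_of_between : ∀ c : ℝ, ∀ᵐ x ∂ν, x ∈ A → u₂ x < c → c < u₁ x → g₂ x = 0 := by
    intro c
    -- The competitor `max u₂ (min u₁ c)` equals `u₁` on `L`, the constant `c` on `M` and `u₂` on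
    -- `R`.
    set L := A ∩ {x | u₁ x ≤ c} with hL
    set M := A ∩ {x | u₂ x < c ∧ c < u₁ x} with hM
    set R := (F \ A) ∪ (A ∩ {x | (c : EReal) ≤ u₂ x}) with hR
    have hLm : NullMeasurableSet L ν := hAm.inter (hm₁.nullMeasurable measurableSet_Iic)
    have hMm : NullMeasurableSet M ν := hAm.inter
      ((hm₂.nullMeasurable measurableSet_Iio).inter (hm₁.nullMeasurable measurableSet_Ioi))
    have hRm : NullMeasurableSet R ν :=
      (hFm.diff hAm).union (hAm.inter (hm₂.nullMeasurable measurableSet_Ici))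
    have hLR : Disjoint L R := by
      rw [disjoint_left]
      rintro x ⟨hxA, hx⟩ (h | h)
      · exact h.2 hxA
      · exact absurd hxA.2 (not_lt.2 (le_trans hx h.2))
    have hMR : Disjoint M R := by
      rw [disjoint_left]
      rintro x ⟨hxA, hx⟩ (h | h)
      · exact h.2 hxA
      · exact absurd hx.1 (not_lt.2 h.2)
    have hML : Disjoint M L := by
      rw [disjoint_left]
      rintro x ⟨hxA, hx⟩ h
      exact absurd hx.2 (not_lt.2 h.2)
    have hwug := h₁.max_min_const hp hE h₂ c
    have key : ∫⁻ x in M ∪ L, g₂ x ^ p ∂ν ≤ ∫⁻ x in L, g₁ x ^ p ∂ν := by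
      refine lintegral_le_of_le_indicator_add hp0 hgm₂ hLm hRm (hMm.union hLm) hLR
        (disjoint_union_left.2 ⟨hMR, hLR⟩) h₂.lt_top ?_
      refine hmin₂ _ _ _ (hm₂.max (hm₁.min aemeasurable_const)) hwug (fun x => le_max_left _ _)
        (fun x => max_le (le_max_right _ _) ((min_le_left _ _).trans (le_max_left _ _))) ?_
      refine hwug.of_pieces hp hE
        (k := fun o : Option Bool => o.elim (fun _ => c)
          fun b => cond b (fun x => (u₁ x).toReal) fun x => (u₂ x).toReal)
        (gk := fun o => o.elim (fun _ => 0) fun b => cond b g₁ g₂)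
        (by
          rintro (_ | _ | _)
          exacts [.of_forall fun γ _ => derivBound_const γ c, hk₂, hk₁]) hFe
        ((hgm₁.indicator₀ hLm).add (hgm₂.indicator₀ hRm)) fun x _ hx => ?_
      by_cases hxA : x ∈ A
      · rcases le_or_gt (u₁ x) c with hle | hgt
        · have hxL : x ∈ L := ⟨hxA, hle⟩
          exact ⟨some true, by simp [min_eq_left hle, max_eq_right hxA.2.le], by simp [hxL]⟩
        · rcases le_or_gt (c : EReal) (u₂ x) with hle' | hgt'
          · have hxR : x ∈ R := Or.inr ⟨hxA, hle'⟩
            exact ⟨some false, by simp [min_eq_right hgt.le, max_eq_left hle'], by simp [hxR]⟩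
          · exact ⟨none, by simp [min_eq_right hgt.le, max_eq_right hgt'.le], by simp⟩
      · have : u₁ x ≤ u₂ x := not_lt.1 fun h => hxA ⟨hx, h⟩
        have hxR : x ∈ R := Or.inl ⟨hx, hxA⟩
        exact ⟨some false, by simp [max_eq_left ((min_le_left _ _).trans this)], by simp [hxR]⟩
    -- Since the gradients already agree on `A`, the integrals over `L` cancel in `key` and nothing
    -- is left on `M`.
    have hLeq : ∫⁻ x in L, g₁ x ^ p ∂ν = ∫⁻ x in L, g₂ x ^ p ∂ν := by
      refine lintegral_congr_ae ?_
      filter_upwards [ae_mono (Measure.restrict_mono inter_subset_left le_rfl) heq] with x hx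
      rw [hx]
    have hfin : ∫⁻ x in L, g₂ x ^ p ∂ν ≠ ∞ :=
      ne_top_of_le_ne_top h₂.lt_top.ne (setLIntegral_le_lintegral _ _)
    rw [hLeq, Measure.restrict_union₀ hML.aedisjoint hLm, lintegral_add_measure] at key
    have hzero : ∫⁻ x in M, g₂ x ^ p ∂ν = 0 := by
      refine le_antisymm ?_ bot_le
      refine (ENNReal.add_le_add_iff_right hfin).1 ?_
      rwa [zero_add]
    rw [lintegral_eq_zero_iff' (hgm₂.restrict.pow_const p), EventuallyEq,
      ae_restrict_iff'₀ hMm] at hzero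
    filter_upwards [hzero] with x hx hxA hlt hgt
    simpa [hp0, hp0.le, hp0.not_gt] using hx ⟨hxA, hlt, hgt⟩
  rw [EventuallyEq, ae_restrict_iff'₀ hAm] at heq
  filter_upwards [heq, ae_all_iff.2 fun q : ℚ => eq_zero_of_between q] with x hx hq hxA
  obtain ⟨q, hq₁, hq₂⟩ := EReal.lt_iff_exists_rat_btwn.1 hxA.2
  have h0 := hq q hxA (by exact_mod_cast hq₁) (by exact_mod_cast hq₂)
  exact ⟨(hx hxA).trans h0, h0⟩

/-- If the gradients of `u₁` and `u₂` vanish where `u₂ < u₁`, then so does that of the positive part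
of `u₁ - u₂`. -/
theorem isWeakUpperGradient_pos_sub (hp : 1 < p) (hE : MeasurableSet E)
    (hm₁ : AEMeasurable u₁ (μ.restrict E)) (hm₂ : AEMeasurable u₂ (μ.restrict E))
    (h₁ : IsLpWeakUpperGradient μ p E u₁ g₁) (h₂ : IsLpWeakUpperGradient μ p E u₂ g₂)
    (hzero : ∀ᵐ x ∂μ.restrict E, x ∈ contactComplement u₁ u₂ → g₁ x = 0 ∧ g₂ x = 0) :
    IsLpWeakUpperGradient μ p E
      (fun x => ((Max.max ((u₁ x).toReal - (u₂ x).toReal) 0 : ℝ) : EReal)) fun _ => 0 := by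
  have hp0 : 0 < p := zero_lt_one.trans hp
  refine ⟨?_, by simp [hp0]⟩
  have hd : IsLpWeakUpperGradient μ p E
      (fun x => ((Max.max ((u₁ x).toReal - (u₂ x).toReal) 0 : ℝ) : EReal))
      fun x => g₁ x + g₂ x := by
    refine h₁.comp hp hE h₂ (φ := fun a b => Max.max (a - b) 0) (fun a b a' b' => ?_)
      fun x _ _ => rfl
    refine (abs_max_sub_max_le_max _ _ _ _).trans (max_le ?_ ?_)
    · rw [show a - b - (a' - b') = (a - a') - (b - b') by ring]
      exact abs_sub _ _
    · simp only [sub_self, abs_zero]; positivity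
  set A := contactComplement u₁ u₂ with hA
  have hAm : NullMeasurableSet A (μ.restrict E) :=
    (nullMeasurableSet_finiteSet hm₁ hm₂).inter (nullMeasurableSet_lt hm₂ hm₁)
  -- The positive part is `u₁ - u₂` on `A` and `0` at the other points of the finite set, so its
  -- gradient is supported in `A`, where both `g₁` and `g₂` vanish a.e.
  have hG := hd.of_pieces hp hE (G := A.indicator fun x => g₁ x + g₂ x)
    (k := fun b : Bool => cond b (fun x => (u₁ x).toReal - (u₂ x).toReal) fun _ => 0)
    (gk := fun b => cond b (fun x => g₁ x + g₂ x) fun _ => 0) (by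
      rintro (_ | _)
      · exact .of_forall fun γ _ => derivBound_const γ 0
      · filter_upwards [h₁.eventually_acBound hp hE, h₂.eventually_acBound hp hE] with γ a b hin
        exact (a hin).derivBound.sub (b hin).derivBound)
    (h₁.eventually_mem_finiteSet hp hE h₂) ((h₁.weak.1.add h₂.weak.1).indicator₀ hAm) (by
      intro x _ hx
      by_cases hxA : x ∈ A
      · have := (toReal_lt_iff hx.2 hx.1).2 hxA.2
        exact ⟨true, (EReal.toReal_coe _).trans (max_eq_left (sub_nonneg.2 this.le)), by simp [hxA]⟩
      · have h : u₁ x ≤ u₂ x := not_lt.1 fun h => hxA ⟨hx, h⟩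
        have := toReal_mono_of_finite hx.1 hx.2 h
        exact ⟨false, by simp [this], by simp⟩)
  refine hG.congr_ae hp0 hE ?_
  filter_upwards [hzero] with x hx
  by_cases hxA : x ∈ A
  · simp [hxA, hx hxA]
  · simp [hxA]

/-- If the extension by zero of the positive part of `u₁ - u₂` has an integrable weak upper
gradient, and its weak upper gradient in the open set `Ω` vanishes, then the indicator function of
the set where `u₂ < u₁` is constant along almost every curve. -/
theorem eventually_mem_iff_of_pos_sub (hp : 1 < p) (hΩ : IsOpen Ω) {d w : X → EReal}
    {H : X → ℝ≥0∞}
    (h₁ : IsLpWeakUpperGradient μ p Ω u₁ g₁) (h₂ : IsLpWeakUpperGradient μ p Ω u₂ g₂)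
    (hd : ∀ x, d x = ((Max.max ((u₁ x).toReal - (u₂ x).toReal) 0 : ℝ) : EReal))
    (hd0 : IsLpWeakUpperGradient μ p Ω d fun _ => 0) (hw : ∀ x ∈ Ω, w x = d x)
    (hw0 : ∀ x ∉ Ω, w x = 0) (hH : IsLpWeakUpperGradient μ p univ w H) :
    ∀ᶠ γ in curveFilter μ p, (γ.toFun 0 ∈ {x | x ∈ Ω ∧ u₂ x < u₁ x} ↔
      γ.toFun γ.length ∈ {x | x ∈ Ω ∧ u₂ x < u₁ x}) := by
  have hp0 : 0 < p := zero_lt_one.trans hp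
  filter_upwards [hH.eventually_acBound hp .univ, h₁.eventually_finite hp hΩ,
    h₂.eventually_finite hp hΩ,
    eventually_sub hp0 ((weakUpperGradient_modulus_iff hp0).1 hd0.weak.2)] with γ a b₁ b₂ hsub
  have hl := γ.length_pos
  -- Along `γ` both functions are finite inside `Ω`, so there the set is exactly `{w ≠ 0}`.
  have hmem : ∀ t ∈ Icc 0 γ.length, (γ.toFun t ∈ {x | x ∈ Ω ∧ u₂ x < u₁ x} ↔
      (w (γ.toFun t)).toReal ≠ 0) := by
    intro t ht
    by_cases hm : γ.toFun t ∈ Ω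
    · have := toReal_lt_iff (b₂ t ht hm) (b₁ t ht hm)
      rw [hw _ hm, hd, EReal.toReal_coe, mem_ofPred_eq, ← this]
      constructor
      · rintro ⟨-, h⟩
        rw [max_eq_left (by linarith)]
        linarith
      · intro h
        refine ⟨hm, not_le.1 fun hle => h (max_eq_right (by linarith))⟩
    · rw [hw0 _ hm]
      simp [hm]
  have key : ∀ s t, 0 ≤ s → s < t → t ≤ γ.length → (∀ τ ∈ Icc s t, γ.toFun τ ∈ Ω) →
      (w (γ.toFun s)).toReal = (w (γ.toFun t)).toReal := by
    intro s t hs hst ht hin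
    have h := hsub s t hs hst ht fun τ hτ => by
      have h2 : τ ≤ t - s := hτ.2
      exact hin (s + τ) ⟨by linarith [hτ.1], by linarith⟩
    rw [hw _ (hin s ⟨le_rfl, hst.le⟩), hw _ (hin t ⟨hst.le, le_rfl⟩)]
    unfold UpperGradientIneq Curve.integral at h
    simp only [Curve.sub_toFun, Curve.sub_length, add_zero, add_sub_cancel, lintegral_const,
      zero_mul, nonpos_iff_eq_zero] at h
    obtain ⟨c₁, c₂⟩ := ne_of_gap_ne_top (by rw [h]; simp)
    rw [gap_of_ne c₁ c₂, ENNReal.ofReal_eq_zero, abs_nonpos_iff, sub_eq_zero] at h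
    exact h
  refine (hmem 0 ⟨le_rfl, hl.le⟩).trans (Iff.trans ?_ (hmem _ ⟨hl.le, le_rfl⟩).symm)
  refine ne_zero_iff_of_locally_const (k := fun t => (w (γ.toFun t)).toReal) hl.le ?_ ?_
  · have := (a fun _ _ => mem_univ _).ac.continuousOn
    rwa [uIcc_of_le hl.le] at this
  -- A nonzero value of `w` forces the point into the open set `Ω`. The curve stays there for nearby
  -- times, and `key` makes `w` constant along these pieces.
  · intro t ht hne
    obtain ⟨δ, hδ, hin⟩ := γ.exists_forall_mem hΩ ht ((hmem t ht).2 hne).1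
    refine ⟨δ, hδ, fun s hs hst => ?_⟩
    obtain ⟨l1, l2⟩ := abs_lt.1 hst
    rcases lt_trichotomy s t with hlt | rfl | hgt
    · exact key s t hs.1 hlt ht.2 fun τ hτ => hin τ ⟨hs.1.trans hτ.1, hτ.2.trans ht.2⟩
        (abs_lt.2 ⟨by linarith [hτ.1], by linarith [hτ.2]⟩)
    · rfl
    · exact (key t s ht.1 hgt hs.2 fun τ hτ => hin τ ⟨ht.1.trans hτ.1, hτ.2.trans hs.2⟩
        (abs_lt.2 ⟨by linarith [hτ.1], by linarith [hτ.2]⟩)).symm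

end Gluing

end MetricObstacle

/-! ### The comparison principle -/

theorem lemma3p6 {X : Type*} [MetricSpace X] [ProperSpace X] [MeasurableSpace X] [BorelSpace X]
    (μ : Measure X) (hμ : ∀ (x : X) (r : ℝ), 0 < r → 0 < μ (ball x r) ∧ μ (ball x r) < ∞)
    (p : ℝ) (hp : 1 < p) (hPI : SupportsPoincare μ p p)
    (Ω : Set X) (hΩ : IsOpen Ω) (hΩne : Ω.Nonempty) (hcap : 0 < capacity μ p Ωᶜ)
    (ψ₁ ψ₂ f₁ f₂ u₁ u₂ : X → EReal)
    (hf₁ : MemDirichlet μ p Ω f₁) (hf₂ : MemDirichlet μ p Ω f₂)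
    (hu₁ : IsObstacleSolution μ p Ω ψ₁ f₁ u₁) (hu₂ : IsObstacleSolution μ p Ω ψ₂ f₂ u₂)
    (hψ : QuasieverywhereIn μ p Ω (fun x => ψ₁ x ≤ ψ₂ x))
    (hf : MemDirichletZero μ p Ω (fun x => max (f₁ x - f₂ x) 0)) :
    QuasieverywhereIn μ p Ω (fun x => u₁ x ≤ u₂ x) := by
  have hp0 : 0 < p := zero_lt_one.trans hp
  have hm := hΩ.measurableSet
  have m₁ := hu₁.1.1.1
  have m₂ := hu₂.1.1.1
  have l₁ := hu₁.1.1.isLpWeakUpperGradient hp hm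
  have l₂ := hu₂.1.1.isLpWeakUpperGradient hp hm
  have hzero := gradients_eq_zero hp hm m₁ m₂ l₁ l₂
    (fun v g G hvm hv hle hle' hG =>
      hu₁.lintegral_le_of_min_between hp hΩ hf₁ hf₂ hu₂.1 hψ hf hvm hv hle hle' hG)
    (fun v g G hvm hv hle hle' hG =>
      hu₂.lintegral_le_of_between_max hp hΩ hf₁ hf₂ hu₁.1.1 hu₁.1.2.1 hf hvm hv hle hle' hG)
  have hd := isWeakUpperGradient_pos_sub hp hm m₁ m₂ l₁ l₂ hzero
  set d : X → EReal := fun x => ((max ((u₁ x).toReal - (u₂ x).toReal) 0 : ℝ) : EReal) with hddef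
  obtain ⟨S, D, hS0, hDm, hDi, hS, hSle⟩ :=
    exists_dominating_function hp hΩ hu₁.1.1 hu₂.1.1 hf₁ hf₂ hu₁.1.2.1 hu₂.1.2.1 hf
  obtain ⟨H, hH⟩ := hd.extend_zero hp hm (w := Ω.indicator d)
    (fun x hx => indicator_of_mem hx _) (fun x hx => indicator_of_notMem hx _) hS0 hDm hDi hS (by
      filter_upwards [hSle] with γ h t ht hmem
      refine ⟨⟨EReal.coe_ne_top _, EReal.coe_ne_bot _⟩, ?_⟩
      -- The domination comes from `U₁ - U₂ = (U₁ - F₁) + (F₁ - F₂) - (U₂ - F₂)`.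
      rw [(h t ht hmem).2, hddef, EReal.toReal_coe, abs_of_nonneg (le_max_right _ _)]
      generalize (u₁ (γ.toFun t)).toReal = U₁
      generalize (u₂ (γ.toFun t)).toReal = U₂
      generalize (f₁ (γ.toFun t)).toReal = F₁
      generalize (f₂ (γ.toFun t)).toReal = F₂
      have k1 := le_abs_self (U₁ - F₁)
      have k2 := neg_abs_le (U₂ - F₂)
      have k3 := le_max_left (F₁ - F₂) 0
      have k4 := le_max_right (F₁ - F₂) 0
      have k5 := abs_nonneg (U₁ - F₁)
      have k6 := abs_nonneg (U₂ - F₂)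
      exact max_le (by linarith) (by linarith))
  have hev := eventually_mem_iff_of_pos_sub hp hΩ l₁ l₂ (fun x => rfl) hd
    (fun x hx => indicator_of_mem hx _) (fun x hx => indicator_of_notMem hx _) hH
  have hTm : NullMeasurableSet {x | x ∈ Ω ∧ u₂ x < u₁ x} μ := by
    have := (nullMeasurableSet_restrict hm.nullMeasurableSet).1 (nullMeasurableSet_lt m₂ m₁)
    rwa [inter_comm] at this
  have : Nonempty X := ⟨hΩne.some⟩
  rcases capacity_eq_zero_or_compl hp0 hμ hPI hTm hev with h | h
  · unfold QuasieverywhereIn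
    simpa only [not_le] using h
  -- This alternative would give `Ωᶜ` capacity zero; it is here that the positive capacity of the
  -- complement rules out a nonzero constant difference.
  · have hsub : Ωᶜ ⊆ {x | x ∈ Ω ∧ u₂ x < u₁ x}ᶜ := fun x hx hx' => hx hx'.1
    exact absurd (capacity_eq_zero_of_subset hsub h) hcap.ne'
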